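/- **Setting.** Let $\mathcal S,\mathcal A$ be nonempty finite sets, $P^a_{s,s'}$ transition probabilities, $r_{s,s'}(a)\in\mathbb R$ rewards ($s,s'\in\mathcal S$, $a\in\mathcal A$), $\gamma\in[0,1)$ a discount factor, $\beta\ge 0$ the price of a transmission, and $T_{\max}\ge 1$ the maximal inter-transmission time. At time $t$ the encoder sees $\langle s_t,\Delta_t,\ell_t\rangle$: the state of the process, the time since the last transmission, and the last transmitted state. An encoder policy is a map $\pi_{\rm e}:\mathcal S\times\{0,\dots,T_{\max}\}\times\mathcal S\to\{0,1\}$. The encoder transmits ($c_t=1$, after which $\Delta_t=0$, $\ell_t=s_t$) if $\Delta_t=T_{\max}$, or if $0<\Delta_t<T_{\max}$ and $\pi_{\rm e}(s_t,\Delta_t,\ell_t)=1$; otherwise $c_t=0$. Then the decoder applies $a_t=\pi_{\rm d}(\ell_t,\Delta_t)$, where $\pi_{\rm d}:\mathcal S\times\{0,\dots,T_{\max}\}\to\mathcal A$ is its policy; the process moves to $s_{t+1}\sim P^{a_t}_{s_t,\cdot}$, and $\Delta$ grows by one. Initially $\Delta_0=0$ and $\ell_0=s_0$, with $s_0\sim\xi$.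 In the push-based game with initial distribution $\xi$, the moves of the two players are $\pi_{\rm e}$ and $\pi_{\rm d}$, and both players have the payoff $$R_\xi(\pi_{\rm e},\pi_{\rm d})=\mathbb E\Big[\sum_{t\ge0}\gamma^t\big(r_{s_t,s_{t+1}}(a_t)-\beta c_t\big)\Big].$$ **Algorithm.** Alternating policy iteration (API) starts from arbitrary policies $(\pi_{\rm e},\pi_{\rm d})$. A round first runs policy iteration for the decoder, with $\pi_{\rm e}$ fixed, to get $\pi_{\rm d}'$, and then policy iteration for the encoder, with $\pi_{\rm d}'$ fixed, to get $\pi_{\rm e}'$. If neither policy has changed, API halts and returns them; otherwise the next round starts from $(\pi_{\rm e}',\pi_{\rm d}')$. The encoder's problem is the Markov decision process on the states $\langle s,\Delta,\ell\rangle$. In the decoder's problem a decision is made whenever a state $\ell$ is received, and consists of the actions $\pi_{\rm d}(\ell,0),\dots,\pi_{\rm d}(\ell,T_{\max})$ to be used until the next transmission; its expected reward, and the law of the next transmission, are computed from the belief that takes the encoder's policy into account. Policy iteration starts from the current policy, alternates exact policy evaluation (Gauss–Jordan elimination) with greedy improvement, keeps the current decision wherever it is greedy, and halts when nothing changes. A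 step is an arithmetic operation on, or a comparison of, two real numbers, or the writing of a table entry. API with tolerance $\varepsilon$ runs the same rounds, but halts as soon as the second phase of a round improves the value by at most $\varepsilon$ in every initial state, and then returns $(\pi_{\rm e},\pi_{\rm d}')$. **Lemma.** 1. For every $\xi$, the push-based game is an exact potential game with potential $R_\xi$. 2. API is iterated best response: from every pair of policies a round can be carried out (both its phases halt), and, for every $\xi$, $\pi_{\rm d}'$ is a best response to $\pi_{\rm e}$, and $\pi_{\rm e}'$ is a best response to $\pi_{\rm d}'$. 3. From every initial pair of policies, API halts after finitely many steps, and the pair that it returns is a Nash equilibrium for every $\xi$. 4. For every $T_{\max}$ there is an exponent $q$, and for every $T_{\max}$ and $\gamma$ there is a constant $K$, such that the following holds for all $\mathcal S,\mathcal A,P,r,\beta$, all $B$ with $|r|\le B$ and $\beta\le B$, all $\varepsilon>0$, and all initial pairs of policies. Within at most $K(|\mathcal A||\mathcal S|)^q(1+B/\varepsilon)$ steps, (a) the rounds of API reach a pair of policies that is an $\varepsilon$-Nash equilibrium for every $\xi$, and (b) API with tolerance $\varepsilon$ halts and returns a pair of policies that is an $\varepsilon$-Nash equilibrium for every $\xi$.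 -/

import Mathlib

/-! ## Unit-cost real arithmetic

`Timed α` is a value together with the number of elementary steps spent on producing it.  An
arithmetic operation on two reals or a comparison of two reals costs one step; writing one entry of a
table, or accumulating one term of a sum, costs one step on top of the steps spent on that entry or
term (this step also pays for the index bookkeeping of that entry). -/

structure Timed (α : Type) where
  val : α
  time : ℕ

namespace Timed

instance : Monad Timed where
  pure a := ⟨a, 0⟩
  bind x f := ⟨(f x.val).val, x.time + (f x.val).time⟩

noncomputable def add (a b : ℝ) : Timed ℝ := ⟨a + b, 1⟩

noncomputable def sub (a b : ℝ) : Timed ℝ := ⟨a - b, 1⟩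

noncomputable def mul (a b : ℝ) : Timed ℝ := ⟨a * b, 1⟩

noncomputable def div (a b : ℝ) : Timed ℝ := ⟨a / b, 1⟩

open Classical in
noncomputable def less (a b : ℝ) : Timed Bool := ⟨decide (a < b), 1⟩

/-- Fill a table indexed by `X`. -/
def tabulate {X α : Type} [Fintype X] (f : X → Timed α) : Timed (X → α) :=
  ⟨fun x => (f x).val, ∑ x, ((f x).time + 1)⟩

/-- Add up the numbers computed by `f`. -/
noncomputable def total {X : Type} [Fintype X] (f : X → Timed ℝ) : Timed ℝ :=
  ⟨∑ x, (f x).val, ∑ x, ((f x).time + 1)⟩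

/-- Scan a list for a maximiser of `q`, starting from the incumbent `u₀`, which is replaced only by
strictly better entries. -/
noncomputable def scanMax {U : Type} (us : List U) (q : U → ℝ) (u₀ : U) : Timed U :=
  us.foldlM (fun best u => do
    let b ← less (q best) (q u)
    if b then pure u else pure best) u₀

end Timed

/-! ## Gauss-Jordan elimination -/

structure LinSys (X : Type) where
  mat : X → X → ℝ
  rhs : X → ℝ

namespace LinSys

variable {X : Type} [Fintype X] [DecidableEq X]

/-- Use row `p` to clear column `p` in all other rows. -/
noncomputable def pivot (L : LinSys X) (p : X) : Timed (LinSys X) := do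
  let m ← Timed.tabulate fun i => Timed.tabulate fun j =>
    if i = p then pure (L.mat i j) else do
      let f ← Timed.div (L.mat i p) (L.mat p p)
      let g ← Timed.mul f (L.mat p j)
      Timed.sub (L.mat i j) g
  let b ← Timed.tabulate fun i =>
    if i = p then pure (L.rhs i) else do
      let f ← Timed.div (L.mat i p) (L.mat p p)
      let g ← Timed.mul f (L.rhs p)
      Timed.sub (L.rhs i) g
  pure ⟨m, b⟩

/-- Eliminate along all the pivots in the list, then divide by the diagonal. -/
noncomputable def solve (pivots : List X) (L : LinSys X) : Timed (X → ℝ) := do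
  let L' ← pivots.foldlM pivot L
  Timed.tabulate fun i => Timed.div (L'.rhs i) (L'.mat i i)

end LinSys

/-! ## Policy iteration -/

/-- A finite discounted decision problem: `rew x u` is the expected reward of action `u` in state `x`,
and `ker x u y` is the transition probability to the next decision state `y`, already multiplied by
the discount accumulated until then (in expectation, if the duration of the stage is random). -/
structure DiscountedMDP (X U : Type) where
  rew : X → U → ℝ
  ker : X → U → X → ℝ

namespace DiscountedMDP

instance : FinEnum Bool := FinEnum.ofNodupList [false, true] (by simp) (by simp)

variable {X U : Type} [Fintype X] [Fintype U] [FinEnum X] [FinEnum U]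

/-- Policy evaluation: solve `v x = rew x (π x) + ∑ y, ker x (π x) y * v y`. -/
noncomputable def evaluate (D : DiscountedMDP X U) (π : X → U) : Timed (X → ℝ) := do
  let m ← Timed.tabulate fun x => Timed.tabulate fun y =>
    Timed.sub (if x = y then 1 else 0) (D.ker x (π x) y)
  LinSys.solve (FinEnum.toList X) ⟨m, fun x => D.rew x (π x)⟩

/-- Policy improvement: in every state, pass to an action that is greedy with respect to `v`; the
current action is kept if it is greedy. -/
noncomputable def improve (D : DiscountedMDP X U) (π : X → U) (v : X → ℝ) : Timed (X → U) :=
  Timed.tabulate fun x => do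
    let q ← Timed.tabulate fun u => do
      let e ← Timed.total fun y => Timed.mul (D.ker x u y) (v y)
      Timed.add (D.rew x u) e
    Timed.scanMax (FinEnum.toList U) q (π x)

/-- `D.PolicyIteration π π' v t`: policy iteration started from `π` halts after `t` steps, and returns
the policy `π'` and its value function `v`.  Each pass evaluates the current policy, improves it, and
halts if the improved policy is the current one (a test of `Fintype.card X` steps). -/
inductive PolicyIteration (D : DiscountedMDP X U) :
    (X → U) → (X → U) → (X → ℝ) → ℕ → Prop
  | halt (π : X → U) (h : (D.improve π (D.evaluate π).val).val = π) :
      PolicyIteration D π π (D.evaluate π).val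
        ((D.evaluate π).time + (D.improve π (D.evaluate π).val).time + Fintype.card X)
  | next (π π' : X → U) (v : X → ℝ) (t : ℕ)
      (h : (D.improve π (D.evaluate π).val).val ≠ π)
      (rest : PolicyIteration D (D.improve π (D.evaluate π).val).val π' v t) :
      PolicyIteration D π π' v
        ((D.evaluate π).time + (D.improve π (D.evaluate π).val).time + Fintype.card X + t)

end DiscountedMDP

/-! ## Two-player games -/

/-- A two-player game in strategic form. -/
structure TwoPlayerGame (E D : Type) where
  payoffE : E → D → ℝ
  payoffD : E → D → ℝ

namespace TwoPlayerGame

variable {E D : Type}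

/-- A unilateral deviation changes the deviator's payoff exactly as it changes `Φ`. -/
def IsExactPotential (G : TwoPlayerGame E D) (Φ : E → D → ℝ) : Prop :=
  (∀ e e' d, G.payoffE e d - G.payoffE e' d = Φ e d - Φ e' d) ∧
  (∀ e d d', G.payoffD e d - G.payoffD e d' = Φ e d - Φ e d')

def IsBestResponseE (G : TwoPlayerGame E D) (e : E) (d : D) : Prop :=
  ∀ e', G.payoffE e' d ≤ G.payoffE e d

def IsBestResponseD (G : TwoPlayerGame E D) (d : D) (e : E) : Prop :=
  ∀ d', G.payoffD e d' ≤ G.payoffD e d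

def IsNash (G : TwoPlayerGame E D) (e : E) (d : D) : Prop :=
  G.IsBestResponseE e d ∧ G.IsBestResponseD d e

def IsEpsNash (G : TwoPlayerGame E D) (ε : ℝ) (e : E) (d : D) : Prop :=
  (∀ e', G.payoffE e' d ≤ G.payoffE e d + ε) ∧ (∀ d', G.payoffD e d' ≤ G.payoffD e d + ε)

end TwoPlayerGame

/-! ## Push-based remote control -/

/-- The data of the remote control problem: transition probabilities `P s a s'`, rewards `r s a s'`,
discount factor `γ`, price `β` of a transmission, maximal inter-transmission time `Tmax`. -/
structure RemoteControl (S A : Type) [Fintype S] where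
  P : S → A → S → ℝ
  P_nonneg : ∀ s a s', 0 ≤ P s a s'
  P_sum : ∀ s a, ∑ s', P s a s' = 1
  r : S → A → S → ℝ
  γ : ℝ
  γ_nonneg : 0 ≤ γ
  γ_lt_one : γ < 1
  β : ℝ
  β_nonneg : 0 ≤ β
  Tmax : ℕ
  Tmax_pos : 1 ≤ Tmax

namespace RemoteControl

section Model

variable {S A : Type} [Fintype S] (M : RemoteControl S A)

/-- Values of the elapsed time `Δ ∈ {0, …, Tmax}` since the last transmission. -/
abbrev Age : Type := Fin (M.Tmax + 1)

/-- The encoder's state `⟨s, Δ, l⟩` at the beginning of a time step: current state of the process, time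
since the last transmission, last transmitted state. -/
abbrev EncState : Type := S × M.Age × S

/-- `true` means "transmit". -/
abbrev EncoderPolicy : Type := M.EncState → Bool

/-- The control action as a function of the last received state and of its age. -/
abbrev DecoderPolicy : Type := S → M.Age → A

/-- Whether a message is sent at age `Δ` if the encoder's decision is `c`.  At age `Δ = 0` the decoder
already has the current state, and nothing is sent; at age `Tmax` a transmission is always
triggered. -/
def sent (Δ : M.Age) (c : Bool) : Bool :=
  if Δ = 0 then false else if Δ = Fin.last M.Tmax then true else c

/-- The age at the next time step.  (The truncation is never active: at age `Tmax` a message is sent,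
and the age is reset to `0` before it increases.) -/
def nextAge (Δ : M.Age) : M.Age := Fin.ofNat (M.Tmax + 1) (min (Δ.val + 1) M.Tmax)

/-- What the decoder knows (last received state and its age) after the communication substep, when
the encoder's decision in `z` is `c`. -/
def received (z : M.EncState) (c : Bool) : S × M.Age :=
  if M.sent z.2.1 c then (z.1, 0) else (z.2.2, z.2.1)

/-- The control action that is applied in `z`. -/
def control (πd : M.DecoderPolicy) (z : M.EncState) (c : Bool) : A :=
  πd (M.received z c).1 (M.received z c).2

/-- Expected value of `r_t - β c_t` given the encoder's state at time `t`. -/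
noncomputable def stageReward (πe : M.EncoderPolicy) (πd : M.DecoderPolicy) (z : M.EncState) : ℝ :=
  (∑ s', M.P z.1 (M.control πd z (πe z)) s' * M.r z.1 (M.control πd z (πe z)) s')
    - (if M.sent z.2.1 (πe z) then M.β else 0)

open Classical in
/-- Transition probabilities of the encoder's state under a pair of policies. -/
noncomputable def transition (πe : M.EncoderPolicy) (πd : M.DecoderPolicy)
    (z z' : M.EncState) : ℝ :=
  if z'.2 = (M.nextAge (M.received z (πe z)).2, (M.received z (πe z)).1) then
    M.P z.1 (M.control πd z (πe z)) z'.1 else 0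

open Classical in
/-- Probability that the encoder's state at time `t` is `z`.  At time `0` the process is in `s₀`, and
the decoder knows this. -/
noncomputable def stateProb (πe : M.EncoderPolicy) (πd : M.DecoderPolicy) (s₀ : S) :
    ℕ → M.EncState → ℝ
  | 0, z => if z = (s₀, 0, s₀) then 1 else 0
  | t + 1, z => ∑ y, stateProb πe πd s₀ t y * M.transition πe πd y z

/-- The long-term reward `𝔼 [∑ t, γ ^ t * (r_t - β c_t)]` from the initial state `s₀`. -/
noncomputable def longTermReward (πe : M.EncoderPolicy) (πd : M.DecoderPolicy) (s₀ : S) : ℝ :=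
  ∑' t : ℕ, M.γ ^ t * ∑ z, M.stateProb πe πd s₀ t z * M.stageReward πe πd z

/-- The long-term reward for an initial state with distribution `ξ`. -/
noncomputable def payoff (ξ : S → ℝ) (πe : M.EncoderPolicy) (πd : M.DecoderPolicy) : ℝ :=
  ∑ s, ξ s * M.longTermReward πe πd s

/-- The push-based game: a move is a policy, and both agents receive the same reward. -/
noncomputable def game (ξ : S → ℝ) : TwoPlayerGame M.EncoderPolicy M.DecoderPolicy where
  payoffE := M.payoff ξ
  payoffD := M.payoff ξ

end Model

section Algorithm

variable {S A : Type} [FinEnum S] [FinEnum A] (M : RemoteControl S A)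

/-- The Markov decision problem that the encoder faces when the decoder's policy is `πd`. -/
noncomputable def encoderMDP (πd : M.DecoderPolicy) : Timed (DiscountedMDP M.EncState Bool) := do
  let rew ← Timed.tabulate fun z => Timed.tabulate fun c => do
    let e ← Timed.total fun s' =>
      Timed.mul (M.P z.1 (M.control πd z c) s') (M.r z.1 (M.control πd z c) s')
    if M.sent z.2.1 c then Timed.sub e M.β else pure e
  let ker ← Timed.tabulate fun z => Timed.tabulate fun c => Timed.tabulate fun z' =>
    if z'.2 = (M.nextAge (M.received z c).2, (M.received z c).1) then
      Timed.mul M.γ (M.P z.1 (M.control πd z c) z'.1)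
    else pure 0
  pure ⟨rew, ker⟩

/-- Quantities that the decoder accumulates along an open-loop sequence of control actions. -/
structure Episode (S : Type) where
  /-- `γ ^ Δ` times the probability that the process is in `s` at age `Δ` and that nothing has been
  sent since the last transmission: the decoder's belief before normalisation. -/
  belief : S → ℝ
  /-- Expected discounted reward so far. -/
  rew : ℝ
  /-- Discounted probability that the next transmission has already happened, in state `s'`. -/
  ker : S → ℝ

/-- The decoder's computation up to age `k`, when the last received state is `l`, the sequence of
actions is `a` and the encoder's policy is `πe`.  In the step from age `k` to age `k + 1` the belief is
propagated by the transition matrix of the action `a k`; the part of it on the states in which the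
encoder sends leaves the episode, and not receiving anything rules these states out. -/
noncomputable def episode (πe : M.EncoderPolicy) (l : S) (a : M.Age → A) : ℕ → Timed (Episode S)
  | 0 => do
    let belief ← Timed.tabulate fun s => pure (if s = l then (1 : ℝ) else 0)
    let ker ← Timed.tabulate fun _ => pure (0 : ℝ)
    pure ⟨belief, 0, ker⟩
  | k + 1 => do
    let ep ← episode πe l a k
    let act : A := a (Fin.ofNat (M.Tmax + 1) k)
    let Δ : M.Age := Fin.ofNat (M.Tmax + 1) (k + 1)
    let gain ← Timed.total fun s => do
      let e ← Timed.total fun s' => Timed.mul (M.P s act s') (M.r s act s')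
      Timed.mul (ep.belief s) e
    let prior ← Timed.tabulate fun s' => do
      let p ← Timed.total fun s => Timed.mul (ep.belief s) (M.P s act s')
      Timed.mul M.γ p
    let cost ← Timed.total fun s' =>
      if M.sent Δ (πe (s', Δ, l)) then Timed.mul M.β (prior s') else pure 0
    let rew₁ ← Timed.add ep.rew gain
    let rew₂ ← Timed.sub rew₁ cost
    let ker ← Timed.tabulate fun s' =>
      if M.sent Δ (πe (s', Δ, l)) then Timed.add (ep.ker s') (prior s') else pure (ep.ker s')
    let belief ← Timed.tabulate fun s' =>
      pure (if M.sent Δ (πe (s', Δ, l)) then 0 else prior s')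
    pure ⟨belief, rew₂, ker⟩

/-- The decision problem that the decoder faces when the encoder's policy is `πe`.  Between two
transmissions the decoder receives nothing, so that its decision upon receiving `l` is the whole
sequence of actions to be applied until the next transmission. -/
noncomputable def decoderMDP (πe : M.EncoderPolicy) : Timed (DiscountedMDP S (M.Age → A)) := do
  let ep ← Timed.tabulate fun l => Timed.tabulate fun a => M.episode πe l a M.Tmax
  pure ⟨fun l a => (ep l a).rew, fun l a => (ep l a).ker⟩

/-- The first phase of a round: policy iteration for the decoder, with `πe` fixed, started from
`πd`; it returns the policy `πd'` with value function `v` after `t` steps. -/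
def ControlPolicyIteration (πe : M.EncoderPolicy) (πd πd' : M.DecoderPolicy) (v : S → ℝ) (t : ℕ) :
    Prop :=
  ∃ t', (M.decoderMDP πe).val.PolicyIteration πd πd' v t' ∧ t = (M.decoderMDP πe).time + t'

/-- The second phase of a round: policy iteration for the encoder, with `πd` fixed, started from
`πe`; it returns the policy `πe'` with value function `v` after `t` steps. -/
def CommunicationPolicyIteration (πd : M.DecoderPolicy) (πe πe' : M.EncoderPolicy)
    (v : M.EncState → ℝ) (t : ℕ) : Prop :=
  ∃ t', (M.encoderMDP πd).val.PolicyIteration πe πe' v t' ∧ t = (M.encoderMDP πd).time + t'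

/-- One round, from `(πe, πd)` to `(πe', πd')`; `vd` and `ve` are the value functions that its two
phases return. -/
def Round (πe : M.EncoderPolicy) (πd : M.DecoderPolicy) (πe' : M.EncoderPolicy)
    (πd' : M.DecoderPolicy) (vd : S → ℝ) (ve : M.EncState → ℝ) (t : ℕ) : Prop :=
  ∃ t₁ t₂, M.ControlPolicyIteration πe πd πd' vd t₁ ∧
    M.CommunicationPolicyIteration πd' πe πe' ve t₂ ∧ t = t₁ + t₂

/-- Number of entries of a pair of policies, the cost of comparing two such pairs. -/
def profileSize : ℕ := Fintype.card M.EncState + Fintype.card (S × M.Age)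

/-- `M.API πe πd πe' πd' t`: alternating policy iteration started from `(πe, πd)` halts after `t`
steps and returns `(πe', πd')`. -/
inductive API : M.EncoderPolicy → M.DecoderPolicy → M.EncoderPolicy → M.DecoderPolicy → ℕ → Prop
  | halt (πe : M.EncoderPolicy) (πd : M.DecoderPolicy) (vd : S → ℝ) (ve : M.EncState → ℝ) (t : ℕ)
      (round : M.Round πe πd πe πd vd ve t) :
      API πe πd πe πd (t + M.profileSize)
  | next (πe πe₁ πe' : M.EncoderPolicy) (πd πd₁ πd' : M.DecoderPolicy)
      (vd : S → ℝ) (ve : M.EncState → ℝ) (t t' : ℕ)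
      (round : M.Round πe πd πe₁ πd₁ vd ve t) (changed : ¬ (πd₁ = πd ∧ πe₁ = πe))
      (rest : API πe₁ πd₁ πe' πd' t') :
      API πe πd πe' πd' (t + M.profileSize + t')

/-- `M.APIRounds πe πd n πe' πd' t`: the first `n` rounds of alternating policy iteration, started from
`(πe, πd)`, lead to `(πe', πd')` and take `t` steps. -/
inductive APIRounds (πe : M.EncoderPolicy) (πd : M.DecoderPolicy) :
    ℕ → M.EncoderPolicy → M.DecoderPolicy → ℕ → Prop
  | start : APIRounds πe πd 0 πe πd 0
  | next (n : ℕ) (πe₁ πe₂ : M.EncoderPolicy) (πd₁ πd₂ : M.DecoderPolicy)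
      (vd : S → ℝ) (ve : M.EncState → ℝ) (t t' : ℕ)
      (before : APIRounds πe πd n πe₁ πd₁ t) (round : M.Round πe₁ πd₁ πe₂ πd₂ vd ve t') :
      APIRounds πe πd (n + 1) πe₂ πd₂ (t + t' + M.profileSize)

/-- Alternating policy iteration with tolerance `ε`: the same rounds, but the iteration halts as soon
as the second phase of a round improves the value found by its first phase by at most `ε` in every
initial state, and then returns the pair of policies that was current between the two phases. -/
inductive ApproxAPI (ε : ℝ) :
    M.EncoderPolicy → M.DecoderPolicy → M.EncoderPolicy → M.DecoderPolicy → ℕ → Prop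
  | halt (πe πe₁ : M.EncoderPolicy) (πd πd₁ : M.DecoderPolicy)
      (vd : S → ℝ) (ve : M.EncState → ℝ) (t : ℕ)
      (round : M.Round πe πd πe₁ πd₁ vd ve t) (close : ∀ s, ve (s, 0, s) - vd s ≤ ε) :
      ApproxAPI ε πe πd πe πd₁ (t + 2 * Fintype.card S)
  | next (πe πe₁ πe' : M.EncoderPolicy) (πd πd₁ πd' : M.DecoderPolicy)
      (vd : S → ℝ) (ve : M.EncState → ℝ) (t t' : ℕ)
      (round : M.Round πe πd πe₁ πd₁ vd ve t) (far : ¬ ∀ s, ve (s, 0, s) - vd s ≤ ε)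
      (rest : ApproxAPI ε πe₁ πd₁ πe' πd' t') :
      ApproxAPI ε πe πd πe' πd' (t + 2 * Fintype.card S + t')

end Algorithm

end RemoteControl

/-! Both players receive the same payoff, so it is itself an exact potential, and everything rests
on exact best responses. Against a fixed partner each agent faces a discounted decision problem
whose values at the initial states are the long-term rewards. For the encoder this follows from its
evaluation equations (`longTermReward_eq`). For the decoder, the value is unrolled along the episode
between two transmissions (`encoderValue_eq_episode`), which closes because a transmission is forced
at age `Tmax`. Optimality holds in all initial states at once, hence for every initial distribution.

Policy evaluation is exact because the identity minus a discounted kernel has nonpositive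
off-diagonal entries and positive row sums; elimination preserves this, so no pivot vanishes. Policy
iteration reaches a fixed point after at most `|X| * |U| * k` passes, where `γ ^ k < 1 - γ`: an
action of largest regret is never used again after `k` passes (`exists_abandoned`). For fixed `Tmax`
the decoder has `|A| ^ (Tmax + 1)` action sequences per state, so a round is polynomial.

No round lowers the reward from any initial state. After the first round the encoder's policy is a
fixed point of its policy iteration, so a later round either changes the decoder's policy and
strictly raises `totalReward`, or changes nothing; as there are finitely many pairs, the rounds
stop. For the `ε` bounds, every round before the target is met raises `totalReward` by more than
`ε`, while its absolute value is at most `|S| * (2 * B / (1 - γ))`. -/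

set_option linter.unusedSectionVars false

/-! ### Values and step counts of the elementary computations -/

namespace Timed

@[simp] theorem pure_val {α : Type} (a : α) : (pure a : Timed α).val = a := rfl

@[simp] theorem pure_time {α : Type} (a : α) : (pure a : Timed α).time = 0 := rfl

@[simp] theorem bind_val {α β : Type} (x : Timed α) (f : α → Timed β) :
    (x >>= f).val = (f x.val).val := rfl

@[simp] theorem bind_time {α β : Type} (x : Timed α) (f : α → Timed β) :
    (x >>= f).time = x.time + (f x.val).time := rfl

@[simp] theorem add_val (a b : ℝ) : (add a b).val = a + b := rfl
@[simp] theorem add_time (a b : ℝ) : (add a b).time = 1 := rfl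
@[simp] theorem sub_val (a b : ℝ) : (sub a b).val = a - b := rfl
@[simp] theorem sub_time (a b : ℝ) : (sub a b).time = 1 := rfl
@[simp] theorem mul_val (a b : ℝ) : (mul a b).val = a * b := rfl
@[simp] theorem mul_time (a b : ℝ) : (mul a b).time = 1 := rfl
@[simp] theorem div_val (a b : ℝ) : (div a b).val = a / b := rfl
@[simp] theorem div_time (a b : ℝ) : (div a b).time = 1 := rfl
@[simp] theorem less_time (a b : ℝ) : (less a b).time = 1 := rfl

@[simp] theorem less_val (a b : ℝ) : (less a b).val = true ↔ a < b := by
  simp [less]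

@[simp] theorem tabulate_val {X α : Type} [Fintype X] (f : X → Timed α) (x : X) :
    (tabulate f).val x = (f x).val := rfl

theorem tabulate_time_le {X α : Type} [Fintype X] {f : X → Timed α} {c : ℕ}
    (h : ∀ x, (f x).time ≤ c) : (tabulate f).time ≤ Fintype.card X * (c + 1) := by
  have := Finset.sum_le_card_nsmul Finset.univ (fun x => (f x).time + 1) (c + 1)
    (fun x _ => Nat.succ_le_succ (h x))
  simpa [tabulate] using this

@[simp] theorem total_val {X : Type} [Fintype X] (f : X → Timed ℝ) :
    (total f).val = ∑ x, (f x).val := rfl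

theorem total_time_le {X : Type} [Fintype X] {f : X → Timed ℝ} {c : ℕ}
    (h : ∀ x, (f x).time ≤ c) : (total f).time ≤ Fintype.card X * (c + 1) := by
  have := Finset.sum_le_card_nsmul Finset.univ (fun x => (f x).time + 1) (c + 1)
    (fun x _ => Nat.succ_le_succ (h x))
  simpa [total] using this

theorem foldlM_time_le {α β : Type} {f : β → α → Timed β} {c : ℕ}
    (h : ∀ b a, (f b a).time ≤ c) (l : List α) (b : β) :
    (l.foldlM f b).time ≤ l.length * c := by
  induction l generalizing b with
  | nil => simp
  | cons a l ih =>
    have h₁ := h b a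
    have h₂ := ih (f b a).val
    simp only [List.foldlM_cons, bind_time, List.length_cons, add_mul, one_mul]
    omega

theorem scanMax_time_le {U : Type} (us : List U) (q : U → ℝ) (u₀ : U) :
    (scanMax us q u₀).time ≤ us.length := by
  have := foldlM_time_le (f := fun best u => do
    let b ← less (q best) (q u)
    if b then pure u else pure best) (c := 1) (fun b a => by
      simp only [bind_time, less_time]
      split_ifs <;> simp) us u₀
  simpa [scanMax] using this

/-- The result of a scan maximises `q` over the list, and differs from the incumbent only if it is
strictly better. -/
theorem scanMax_spec {U : Type} (us : List U) (q : U → ℝ) (u₀ : U) :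
    q u₀ ≤ q (scanMax us q u₀).val ∧ (∀ u ∈ us, q u ≤ q (scanMax us q u₀).val) ∧
      ((scanMax us q u₀).val = u₀ ∨ q u₀ < q (scanMax us q u₀).val) := by
  induction us generalizing u₀ with
  | nil => simp [scanMax]
  | cons a us ih =>
    by_cases h : q u₀ < q a
    · have e : (scanMax (a :: us) q u₀).val = (scanMax us q a).val := by
        simp [scanMax, h]
      obtain ⟨h₁, h₂, -⟩ := ih a
      rw [e]
      refine ⟨h.le.trans h₁, ?_, Or.inr (h.trans_le h₁)⟩
      simpa using ⟨h₁, h₂⟩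
    · have e : (scanMax (a :: us) q u₀).val = (scanMax us q u₀).val := by
        simp [scanMax, h]
      obtain ⟨h₁, h₂, h₃⟩ := ih u₀
      rw [e]
      refine ⟨h₁, ?_, h₃⟩
      simpa using ⟨(not_lt.1 h).trans h₁, h₂⟩

end Timed

/-! ### Gauss–Jordan elimination without row exchanges -/

namespace LinSys

variable {X : Type} [Fintype X] [DecidableEq X]

def Solves (L : LinSys X) (v : X → ℝ) : Prop := ∀ i, ∑ j, L.mat i j * v j = L.rhs i

/-- Nonpositive off-diagonal entries and positive row sums: this makes all pivots positive, and is
inherited along the elimination. -/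
structure IsDominant (L : LinSys X) : Prop where
  off_diag : ∀ i j, i ≠ j → L.mat i j ≤ 0
  row_sum : ∀ i, 0 < ∑ j, L.mat i j

def IsCleared (L : LinSys X) (p : X) : Prop := ∀ i, i ≠ p → L.mat i p = 0

theorem IsDominant.diag_pos {L : LinSys X} (h : L.IsDominant) (i : X) : 0 < L.mat i i := by
  have h₁ := h.row_sum i
  rw [← Finset.add_sum_erase _ _ (Finset.mem_univ i)] at h₁
  have h₂ : ∑ j ∈ Finset.univ.erase i, L.mat i j ≤ 0 :=
    Finset.sum_nonpos fun j hj => h.off_diag i j (Finset.ne_of_mem_erase hj).symm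
  linarith

theorem pivot_mat (L : LinSys X) (p i j : X) : (L.pivot p).val.mat i j =
    if i = p then L.mat i j else L.mat i j - L.mat i p / L.mat p p * L.mat p j := by
  simp only [pivot, Timed.bind_val, Timed.pure_val, Timed.tabulate_val]
  split_ifs <;> simp

theorem pivot_rhs (L : LinSys X) (p i : X) : (L.pivot p).val.rhs i =
    if i = p then L.rhs i else L.rhs i - L.mat i p / L.mat p p * L.rhs p := by
  simp only [pivot, Timed.bind_val, Timed.pure_val, Timed.tabulate_val]
  split_ifs <;> simp

theorem pivot_sum (L : LinSys X) (p i : X) (v : X → ℝ) : ∑ j, (L.pivot p).val.mat i j * v j =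
    if i = p then ∑ j, L.mat i j * v j else
      ∑ j, L.mat i j * v j - L.mat i p / L.mat p p * ∑ j, L.mat p j * v j := by
  simp only [pivot_mat]
  split_ifs
  · rfl
  · rw [Finset.mul_sum, ← Finset.sum_sub_distrib]
    exact Finset.sum_congr rfl fun j _ => by ring

/-- Row `p` itself is unchanged, so each row operation can be undone; a nonzero pivot is not needed
for this. -/
theorem pivot_solves (L : LinSys X) (p : X) (v : X → ℝ) :
    (L.pivot p).val.Solves v ↔ L.Solves v := by
  simp only [Solves, pivot_sum, pivot_rhs]
  constructor
  · intro h i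
    have hp := h p
    have hi := h i
    simp only [if_true] at hp
    split_ifs at hi
    · exact hi
    · rw [hp] at hi
      linarith
  · intro h i
    rw [h i, h p]

/-- The multiplier of row `p` is nonpositive, so a nonnegative multiple of that row is added:
off-diagonal entries can only decrease outside column `p`, where they become zero, and row sums can
only grow. -/
theorem IsDominant.dominant_pivot {L : LinSys X} (h : L.IsDominant) (p : X) :
    (L.pivot p).val.IsDominant where
  off_diag i j hij := by
    rw [pivot_mat]
    split_ifs with hi
    · exact h.off_diag i j hij
    · have h₁ : L.mat i p / L.mat p p ≤ 0 :=
        div_nonpos_of_nonpos_of_nonneg (h.off_diag i p hi) (h.diag_pos p).le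
      by_cases hj : p = j
      · subst hj
        rw [div_mul_cancel₀ _ (h.diag_pos p).ne', sub_self]
      · have h₂ := mul_nonneg_of_nonpos_of_nonpos h₁ (h.off_diag p j hj)
        linarith [h.off_diag i j hij]
  row_sum i := by
    have e := L.pivot_sum p i fun _ => 1
    simp only [mul_one] at e
    rw [e]
    split_ifs with hi
    · exact h.row_sum i
    · have h₁ : L.mat i p / L.mat p p ≤ 0 :=
        div_nonpos_of_nonpos_of_nonneg (h.off_diag i p hi) (h.diag_pos p).le
      have h₂ := mul_nonpos_of_nonpos_of_nonneg h₁ (h.row_sum p).le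
      linarith [h.row_sum i]

theorem IsDominant.isCleared_pivot {L : LinSys X} (h : L.IsDominant) (p : X) :
    (L.pivot p).val.IsCleared p := by
  intro i hi
  rw [pivot_mat, if_neg hi, div_mul_cancel₀ _ (h.diag_pos p).ne', sub_self]

/-- For `q ≠ p`, row `p` has a zero in the cleared column `q`, so subtracting multiples of it leaves
that column alone. -/
theorem IsDominant.isCleared_pivot_of_isCleared {L : LinSys X} (h : L.IsDominant) (p : X) {q : X}
    (hq : L.IsCleared q) : (L.pivot p).val.IsCleared q := by
  by_cases hpq : p = q
  · subst hpq
    exact h.isCleared_pivot p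
  · intro i hi
    rw [pivot_mat, hq i hi, hq p hpq]
    simp

theorem IsDominant.eliminate {L : LinSys X} (h : L.IsDominant) (ps : List X) :
    (ps.foldlM pivot L).val.IsDominant ∧
      (∀ v, (ps.foldlM pivot L).val.Solves v ↔ L.Solves v) ∧
      ∀ q, q ∈ ps ∨ L.IsCleared q → (ps.foldlM pivot L).val.IsCleared q := by
  induction ps generalizing L with
  | nil => simpa using h
  | cons p ps ih =>
    obtain ⟨h₁, h₂, h₃⟩ := ih (h.dominant_pivot p)
    simp only [List.foldlM_cons, Timed.bind_val]
    refine ⟨h₁, fun v => (h₂ v).trans (L.pivot_solves p v), fun q hq => h₃ q ?_⟩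
    rcases hq with hq | hq
    · rcases List.mem_cons.1 hq with rfl | hq
      · exact Or.inr (h.isCleared_pivot q)
      · exact Or.inl hq
    · exact Or.inr (h.isCleared_pivot_of_isCleared p hq)

/-- Once every column is cleared the matrix is diagonal with positive diagonal, and division by it
solves the system. -/
theorem IsDominant.solves_solve {L : LinSys X} (h : L.IsDominant) {ps : List X}
    (hps : ∀ p, p ∈ ps) : L.Solves (L.solve ps).val := by
  obtain ⟨h₁, h₂, h₃⟩ := h.eliminate ps
  rw [← h₂]
  intro i
  rw [Finset.sum_eq_single i]
  · simp only [solve, Timed.bind_val, Timed.tabulate_val, Timed.div_val]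
    exact mul_div_cancel₀ _ (h₁.diag_pos i).ne'
  · intro j _ hj
    rw [h₃ j (Or.inl (hps j)) i hj.symm, zero_mul]
  · simp

theorem pivot_time_le (L : LinSys X) (p : X) :
    (L.pivot p).time ≤ Fintype.card X * (Fintype.card X * 4 + 1) + Fintype.card X * 4 := by
  simp only [pivot, Timed.bind_time, Timed.pure_time, add_zero]
  refine Nat.add_le_add (Timed.tabulate_time_le fun i => Timed.tabulate_time_le fun j => ?_)
    (Timed.tabulate_time_le fun i => ?_)
  all_goals
    split_ifs <;> simp

theorem solve_time_le (L : LinSys X) (ps : List X) : (L.solve ps).time ≤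
    ps.length * (Fintype.card X * (Fintype.card X * 4 + 1) + Fintype.card X * 4)
      + Fintype.card X * 2 := by
  simp only [solve, Timed.bind_time]
  exact Nat.add_le_add (Timed.foldlM_time_le pivot_time_le ps L)
    (Timed.tabulate_time_le fun i => by simp)

end LinSys

theorem FinEnum.length_toList (X : Type) [FinEnum X] [Fintype X] :
    (FinEnum.toList X).length = Fintype.card X := by
  classical
  rw [← List.toFinset_card_of_nodup (FinEnum.nodup_toList (α := X)), ← Finset.card_univ]
  congr 1
  ext x
  simp

/-! ### Policy iteration: cost of a pass, and number of passes -/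

namespace DiscountedMDP

variable {X U : Type} [Fintype X] [Fintype U] [FinEnum X] [FinEnum U]

theorem evaluate_time_le (D : DiscountedMDP X U) (π : X → U) :
    (D.evaluate π).time ≤ 14 * Fintype.card X ^ 3 := by
  have h₁ : (D.evaluate π).time ≤ Fintype.card X * (Fintype.card X * 2 + 1) +
      (Fintype.card X * (Fintype.card X * (Fintype.card X * 4 + 1) + Fintype.card X * 4)
        + Fintype.card X * 2) := by
    simp only [evaluate, Timed.bind_time]
    refine Nat.add_le_add (Timed.tabulate_time_le fun i => Timed.tabulate_time_le fun j => ?_) ?_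
    · simp
    · have := LinSys.solve_time_le (⟨fun x y => (if x = y then 1 else 0) - D.ker x (π x) y,
        fun x => D.rew x (π x)⟩ : LinSys X) (FinEnum.toList X)
      rw [FinEnum.length_toList] at this
      exact this
  -- With `n` states, `h₁` bounds the time by `4n³ + 7n² + 3n`, whose coefficients add up to `14`.
  -- Substituting `n = m + 1` leaves a difference with nonnegative coefficients.
  rcases Nat.eq_zero_or_pos (Fintype.card X) with h | h
  · simp [h] at h₁ ⊢
    omega
  · refine h₁.trans ?_
    obtain ⟨m, hm⟩ : ∃ m, Fintype.card X = m + 1 := ⟨_, (Nat.succ_pred_eq_of_pos h).symm⟩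
    rw [hm]
    ring_nf
    nlinarith [Nat.zero_le (m ^ 2), Nat.zero_le (m ^ 3)]

theorem improve_time_le (D : DiscountedMDP X U) (π : X → U) (v : X → ℝ) :
    (D.improve π v).time ≤
      Fintype.card X * (Fintype.card U * (Fintype.card X * 2 + 3) + 1) := by
  refine (Timed.tabulate_time_le
    (c := Fintype.card U * (Fintype.card X * 2 + 2) + Fintype.card U) fun x => ?_).trans
    (le_of_eq (by ring))
  simp only [Timed.bind_time]
  refine Nat.add_le_add (Timed.tabulate_time_le (c := Fintype.card X * 2 + 1) fun u => ?_) ?_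
  · simp only [Timed.bind_time, Timed.add_time]
    exact Nat.add_le_add_right (Timed.total_time_le fun y => by simp) 1
  · exact (Timed.scanMax_time_le _ _ _).trans (FinEnum.length_toList U).le

/-- A pass of policy iteration: evaluation, improvement, and the halting test. -/
theorem pass_time_le (D : DiscountedMDP X U) (π : X → U) :
    (D.evaluate π).time + (D.improve π (D.evaluate π).val).time + Fintype.card X ≤
      21 * (Fintype.card X ^ 3 * Fintype.card U) := by
  rcases isEmpty_or_nonempty X with hX | ⟨⟨x⟩⟩
  · have h₁ := D.evaluate_time_le π
    have h₂ := D.improve_time_le π (D.evaluate π).val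
    simp at h₁ h₂ ⊢
    omega
  have hX : 0 < Fintype.card X := Fintype.card_pos_iff.2 ⟨x⟩
  have hU : 0 < Fintype.card U := Fintype.card_pos_iff.2 ⟨π x⟩
  have h₁ := D.evaluate_time_le π
  have h₂ := D.improve_time_le π (D.evaluate π).val
  -- Every monomial of the cost is absorbed into `n³u`: `14` from evaluation, `2 + 3 + 1` from
  -- improvement and `1` from the halting test give `21`.
  have h₃ : Fintype.card X ^ 3 ≤ Fintype.card X ^ 3 * Fintype.card U := Nat.le_mul_of_pos_right _ hU
  have h₄ : Fintype.card X * Fintype.card U ≤ Fintype.card X ^ 3 * Fintype.card U :=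
    Nat.mul_le_mul_right _ (Nat.le_self_pow (by norm_num) _)
  have h₅ : Fintype.card X ^ 2 * Fintype.card U ≤ Fintype.card X ^ 3 * Fintype.card U :=
    Nat.mul_le_mul_right _ (Nat.pow_le_pow_right hX (by norm_num))
  have h₆ : Fintype.card X ≤ Fintype.card X * Fintype.card U := Nat.le_mul_of_pos_right _ hU
  nlinarith

/-- Expected reward of action `u` in state `x`, if the continuation is worth `v`. -/
def actionValue (D : DiscountedMDP X U) (v : X → ℝ) (x : X) (u : U) : ℝ :=
  D.rew x u + ∑ y, D.ker x u y * v y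

noncomputable def value (D : DiscountedMDP X U) (π : X → U) : X → ℝ := (D.evaluate π).val

/-- The policy after one pass of policy iteration. -/
noncomputable def step (D : DiscountedMDP X U) (π : X → U) : X → U := (D.improve π (D.value π)).val

theorem actionValue_le_step (D : DiscountedMDP X U) (π : X → U) (x : X) (u : U) :
    D.actionValue (D.value π) x u ≤ D.actionValue (D.value π) x (D.step π x) :=
  (Timed.scanMax_spec (FinEnum.toList U) (D.actionValue (D.value π) x) (π x)).2.1 u
    (FinEnum.mem_toList u)

theorem actionValue_lt_step (D : DiscountedMDP X U) (π : X → U) (x : X) (h : D.step π x ≠ π x) :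
    D.actionValue (D.value π) x (π x) < D.actionValue (D.value π) x (D.step π x) :=
  (Timed.scanMax_spec (FinEnum.toList U) (D.actionValue (D.value π) x) (π x)).2.2.resolve_left h

/-- Transitions are substochastic, and discounted at least by the factor `γ < 1`. -/
structure IsContracting (D : DiscountedMDP X U) (γ : ℝ) : Prop where
  nonneg : 0 ≤ γ
  lt_one : γ < 1
  ker_nonneg : ∀ x u y, 0 ≤ D.ker x u y
  ker_sum_le : ∀ x u, ∑ y, D.ker x u y ≤ γ

/-! ### Comparison principles and strong polynomiality -/

namespace IsContracting

variable {D : DiscountedMDP X U} {γ : ℝ} (hD : D.IsContracting γ)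
include hD

/-- Kernel row sums are at most `γ < 1`, so the evaluation matrix is dominant and elimination really
solves the system. -/
theorem value_eq (π : X → U) (x : X) : D.value π x = D.actionValue (D.value π) x (π x) := by
  have h : LinSys.IsDominant (⟨fun x y => (if x = y then 1 else 0) - D.ker x (π x) y,
        fun x => D.rew x (π x)⟩ : LinSys X) := by
    constructor
    · intro i j hij
      simpa [hij] using hD.ker_nonneg i (π i) j
    · intro i
      have := hD.ker_sum_le i (π i)
      have := hD.lt_one
      simp only [Finset.sum_sub_distrib, Finset.sum_ite_eq, Finset.mem_univ, if_true]
      linarith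
  have h' := h.solves_solve (ps := FinEnum.toList X) FinEnum.mem_toList x
  simp only [sub_mul, Finset.sum_sub_distrib, ite_mul, one_mul, zero_mul, Finset.sum_ite_eq,
    Finset.mem_univ, if_true] at h'
  exact sub_eq_iff_eq_add.1 h'

/-- Nonnegativity of `c` matters because the total mass of the kernel may be smaller than `γ`. -/
theorem sum_ker_mul_le {w : X → ℝ} {c : ℝ} (hc : 0 ≤ c) (hw : ∀ x, w x ≤ c) (x : X) (u : U) :
    ∑ y, D.ker x u y * w y ≤ γ * c := by
  calc ∑ y, D.ker x u y * w y ≤ ∑ y, D.ker x u y * c :=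
        Finset.sum_le_sum fun y _ => mul_le_mul_of_nonneg_left (hw y) (hD.ker_nonneg x u y)
    _ = (∑ y, D.ker x u y) * c := (Finset.sum_mul _ _ _).symm
    _ ≤ γ * c := mul_le_mul_of_nonneg_right (hD.ker_sum_le x u) hc

/-- Maximum principle. -/
theorem le_div_of_le_sum {π : X → U} {w : X → ℝ} {δ : ℝ} (hδ : 0 ≤ δ)
    (h : ∀ x, w x ≤ ∑ y, D.ker x (π x) y * w y + δ) (x : X) : w x ≤ δ / (1 - γ) := by
  have hγ : 0 < 1 - γ := sub_pos.2 hD.lt_one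
  have : Nonempty X := ⟨x⟩
  obtain ⟨x₀, hx₀⟩ := Finite.exists_max w
  refine (hx₀ x).trans ?_
  rcases le_or_gt (w x₀) 0 with h0 | h0
  · exact h0.trans (div_nonneg hδ hγ.le)
  · rw [le_div_iff₀ hγ]
    have := hD.sum_ker_mul_le h0.le hx₀ x₀ (π x₀)
    have := h x₀
    linarith

theorem nonpos_of_le_sum {π : X → U} {w : X → ℝ}
    (h : ∀ x, w x ≤ ∑ y, D.ker x (π x) y * w y) (x : X) : w x ≤ 0 := by
  simpa using hD.le_div_of_le_sum (π := π) (δ := 0) le_rfl (by simpa using h) x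

theorem actionValue_mono {v w : X → ℝ} (h : ∀ x, v x ≤ w x) (x : X) (u : U) :
    D.actionValue v x u ≤ D.actionValue w x u :=
  add_le_add_right (Finset.sum_le_sum fun y _ =>
    mul_le_mul_of_nonneg_left (h y) (hD.ker_nonneg x u y)) _

omit hD [Fintype U] [FinEnum X] [FinEnum U] in
theorem _root_.DiscountedMDP.actionValue_sub (D : DiscountedMDP X U) (v w : X → ℝ) (x : X) (u : U) :
    D.actionValue v x u - D.actionValue w x u = ∑ y, D.ker x u y * (v y - w y) := by
  simp only [actionValue, mul_sub, Finset.sum_sub_distrib]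
  ring

/-- The difference of `w` and the value is dominated by its own image under the kernel, so the
maximum principle makes it nonpositive. -/
theorem le_value {π : X → U} {w : X → ℝ} (h : ∀ x, w x ≤ D.actionValue w x (π x)) (x : X) :
    w x ≤ D.value π x := by
  refine sub_nonpos.1 (hD.nonpos_of_le_sum (π := π) (w := fun x => w x - D.value π x)
    (fun x => ?_) x)
  have := D.actionValue_sub w (D.value π) x (π x)
  have := h x
  have := hD.value_eq π x
  linarith

theorem value_le {π : X → U} {w : X → ℝ} (h : ∀ x, D.actionValue w x (π x) ≤ w x) (x : X) :
    D.value π x ≤ w x := by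
  refine sub_nonpos.1 (hD.nonpos_of_le_sum (π := π) (w := fun x => D.value π x - w x)
    (fun x => ?_) x)
  have := D.actionValue_sub (D.value π) w x (π x)
  have := h x
  have := hD.value_eq π x
  linarith

theorem eq_value {π : X → U} {w : X → ℝ} (h : ∀ x, w x = D.actionValue w x (π x)) (x : X) :
    w x = D.value π x :=
  le_antisymm (hD.le_value (fun x => (h x).le) x) (hD.value_le (fun x => (h x).ge) x)

theorem value_le_step (π : X → U) (x : X) : D.value π x ≤ D.value (D.step π) x :=
  hD.le_value (fun x => (hD.value_eq π x).le.trans (D.actionValue_le_step π x _)) x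

/-- Improvement keeps greedy actions, so a changed action is strictly better against the old value,
and the new value is at least the old one everywhere. -/
theorem value_lt_step (π : X → U) (h : D.step π ≠ π) :
    ∃ x, D.value π x < D.value (D.step π) x := by
  obtain ⟨x, hx⟩ := Function.ne_iff.1 h
  refine ⟨x, ?_⟩
  rw [hD.value_eq π x, hD.value_eq (D.step π) x]
  exact (D.actionValue_lt_step π x hx).trans_le (hD.actionValue_mono (hD.value_le_step π) x _)

/-- At a fixed point no action beats the value, which is therefore a supersolution for every policy.
-/
theorem value_le_of_step_eq {π : X → U} (h : D.step π = π) (π' : X → U) (x : X) :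
    D.value π' x ≤ D.value π x := by
  refine hD.value_le (fun x => ?_) x
  have := D.actionValue_le_step π x (π' x)
  rwa [h, ← hD.value_eq] at this

theorem step_eq_of_value_le {π : X → U} (h : ∀ π' x, D.value π' x ≤ D.value π x) :
    D.step π = π := by
  by_contra hne
  obtain ⟨x, hx⟩ := hD.value_lt_step π hne
  exact absurd (h _ x) (not_le.2 hx)

/-- A policy maximising the sum of the values cannot be improved strictly in any state. -/
theorem exists_step_eq [Nonempty (X → U)] : ∃ π : X → U, D.step π = π := by
  obtain ⟨π, hπ⟩ := Finite.exists_max fun π : X → U => ∑ x, D.value π x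
  refine ⟨π, ?_⟩
  by_contra hne
  obtain ⟨x, hx⟩ := hD.value_lt_step π hne
  exact absurd (hπ (D.step π)) (not_le.2
    (Finset.sum_lt_sum (fun x _ => hD.value_le_step π x) ⟨x, Finset.mem_univ x, hx⟩))

/-- One pass of policy iteration shrinks the distance to the optimal value by the factor `γ`. -/
theorem value_sub_step_le {πs π : X → U} {c : ℝ} (hc : 0 ≤ c)
    (h : ∀ x, D.value πs x - D.value π x ≤ c) (x : X) :
    D.value πs x - D.value (D.step π) x ≤ γ * c := by
  have h₁ := D.actionValue_sub (D.value πs) (D.value π) x (πs x)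
  have h₂ := hD.sum_ker_mul_le hc h x (πs x)
  have h₃ := D.actionValue_le_step π x (πs x)
  have h₄ := hD.actionValue_mono (hD.value_le_step π) x (D.step π x)
  rw [← hD.value_eq] at h₁ h₄
  linarith

theorem value_sub_iterate_le {πs π : X → U} {c : ℝ} (hc : 0 ≤ c)
    (h : ∀ x, D.value πs x - D.value π x ≤ c) (i : ℕ) (x : X) :
    D.value πs x - D.value (D.step^[i] π) x ≤ γ ^ i * c := by
  induction i generalizing x with
  | zero => simpa using h x
  | succ i ih =>
    rw [Function.iterate_succ_apply', pow_succ', mul_assoc]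
    exact hD.value_sub_step_le (mul_nonneg (pow_nonneg hD.nonneg i) hc) ih x

/-- While the policy is not optimal, one of its actions is abandoned for good within `k` passes, as
soon as `γ ^ k < 1 - γ`. -/
theorem exists_abandoned {k : ℕ} (hk : γ ^ k < 1 - γ) {π : X → U} (hπ : D.step π ≠ π) :
    ∃ x, ∀ i, k ≤ i → (D.step^[i] π) x ≠ π x := by
  have hγ : 0 < 1 - γ := sub_pos.2 hD.lt_one
  have : Nonempty (X → U) := ⟨π⟩
  obtain ⟨πs, hs⟩ := hD.exists_step_eq
  have : Nonempty X := by
    obtain ⟨x, -⟩ := Function.ne_iff.1 hπ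
    exact ⟨x⟩
  -- The regret of playing `u` once and optimally afterwards. By `hsub`, the deficit of a policy is
  -- its regret plus the discounted deficit at the next state.
  set gap : X → U → ℝ := fun x u => D.value πs x - D.actionValue (D.value πs) x u with hgap
  obtain ⟨x₀, hx₀⟩ := Finite.exists_max fun x => gap x (π x)
  have hsub : ∀ (π' : X → U) x, D.value πs x - D.value π' x =
      ∑ y, D.ker x (π' x) y * (D.value πs y - D.value π' y) + gap x (π' x) := by
    intro π' x
    rw [← D.actionValue_sub, ← hD.value_eq π']
    simp only [hgap]
    ring
  have hle : ∀ (π' : X → U) x, gap x (π' x) ≤ D.value πs x - D.value π' x := by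
    intro π' x
    rw [hsub]
    exact le_add_of_nonneg_left (Finset.sum_nonneg fun y _ => mul_nonneg (hD.ker_nonneg _ _ _)
      (sub_nonneg.2 (hD.value_le_of_step_eq hs π' y)))
  have hpos : 0 < gap x₀ (π x₀) := by
    by_contra hn
    apply hπ
    apply hD.step_eq_of_value_le
    have h₁ : ∀ x, D.value πs x - D.value π x ≤ 0 := hD.nonpos_of_le_sum (π := π) fun x => by
      have := hx₀ x
      rw [hsub π x]
      linarith
    intro π' x
    linarith [h₁ x, hD.value_le_of_step_eq hs π' x]
  -- The deficit of `π` is at most its largest regret divided by `1 - γ`. After `i ≥ k` passes the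
  -- deficit is below that regret itself, whereas by `hle` a policy still using this action at `x₀`
  -- has a deficit at least as large.
  refine ⟨x₀, fun i hi heq => ?_⟩
  have h₁ : ∀ x, D.value πs x - D.value π x ≤ gap x₀ (π x₀) / (1 - γ) :=
    hD.le_div_of_le_sum (π := π) hpos.le fun x => by
      have := hx₀ x
      rw [hsub π x]
      linarith
  have h₂ := hD.value_sub_iterate_le (div_nonneg hpos.le hγ.le) h₁ i x₀
  have h₃ := hle (D.step^[i] π) x₀
  rw [heq] at h₃
  have h₄ : γ ^ i ≤ γ ^ k := pow_le_pow_of_le_one hD.nonneg hD.lt_one.le hi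
  have h₅ : γ ^ i * (gap x₀ (π x₀) / (1 - γ)) < (1 - γ) * (gap x₀ (π x₀) / (1 - γ)) :=
    mul_lt_mul_of_pos_right (h₄.trans_lt hk) (div_pos hpos hγ)
  rw [mul_div_cancel₀ _ hγ.ne'] at h₅
  linarith

/-- Policy iteration with a fixed discount factor is strongly polynomial. -/
theorem exists_iterate_step_eq {k : ℕ} (hk : γ ^ k < 1 - γ) (π : X → U) :
    ∃ i ≤ Fintype.card X * Fintype.card U * k, D.step (D.step^[i] π) = D.step^[i] π := by
  classical
  by_contra! hne
  -- State-action pairs never used from pass `j * k` on. Without a fixed point, each block of `k`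
  -- passes adds a pair, and there are only `|X| * |U|` of them.
  set abandoned : ℕ → Finset (X × U) := fun j =>
    Finset.univ.filter fun z => ∀ i, j * k ≤ i → (D.step^[i] π) z.1 ≠ z.2 with habandoned
  have hcard : ∀ j ≤ Fintype.card X * Fintype.card U + 1, j ≤ (abandoned j).card := by
    intro j
    induction j with
    | zero => simp
    | succ j ih =>
      intro hj
      obtain ⟨x, hx⟩ := hD.exists_abandoned hk
        (hne (j * k) (Nat.mul_le_mul_right k (Nat.le_of_succ_le_succ hj)))
      have hss : abandoned j ⊂ abandoned (j + 1) := by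
        rw [Finset.ssubset_iff_of_subset]
        -- This pair is in use at pass `j * k`, so it is new in the larger set.
        · refine ⟨(x, (D.step^[j * k] π) x), ?_, ?_⟩
          · simp only [habandoned, Finset.mem_filter, Finset.mem_univ, true_and]
            intro i hi
            rw [add_mul, one_mul] at hi
            have := hx (i - j * k) (by omega)
            rwa [← Function.iterate_add_apply, Nat.sub_add_cancel (by omega)] at this
          · simp only [habandoned, Finset.mem_filter, Finset.mem_univ, true_and, not_forall]
            exact ⟨j * k, le_rfl, fun h => h rfl⟩
        · intro z hz
          simp only [habandoned, Finset.mem_filter, Finset.mem_univ, true_and] at hz ⊢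
          exact fun i hi => hz i ((Nat.mul_le_mul_right k j.le_succ).trans hi)
      exact (Nat.succ_le_succ (ih (by omega))).trans (Finset.card_lt_card hss)
  have h₁ := hcard _ le_rfl
  have h₂ := Finset.card_le_univ (abandoned (Fintype.card X * Fintype.card U + 1))
  rw [Fintype.card_prod] at h₂
  omega

omit hD in
-- The index `i` need not be the first fixed pass, as halting earlier only saves time; the extra
-- pass is the one that detects the fixed point.
theorem _root_.DiscountedMDP.exists_policyIteration_of_iterate {D : DiscountedMDP X U} {i : ℕ}
    {π : X → U} (h : D.step (D.step^[i] π) = D.step^[i] π) :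
    ∃ π' v t, D.PolicyIteration π π' v t ∧
      t ≤ (i + 1) * (21 * (Fintype.card X ^ 3 * Fintype.card U)) := by
  induction i generalizing π with
  | zero =>
    refine ⟨_, _, _, .halt π h, ?_⟩
    simpa using D.pass_time_le π
  | succ i ih =>
    have hpass := D.pass_time_le π
    by_cases hπ : D.step π = π
    · refine ⟨_, _, _, .halt π hπ, hpass.trans (Nat.le_mul_of_pos_left _ (Nat.succ_pos _))⟩
    · obtain ⟨π', v, t, h₁, h₂⟩ := ih (π := D.step π) h
      refine ⟨_, _, _, .next π π' v t hπ h₁, ?_⟩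
      rw [add_mul (i + 1) 1, one_mul]
      omega

theorem exists_policyIteration {k : ℕ} (hk : γ ^ k < 1 - γ) (π : X → U) :
    ∃ π' v t, D.PolicyIteration π π' v t ∧ t ≤ (Fintype.card X * Fintype.card U * k + 1) *
      (21 * (Fintype.card X ^ 3 * Fintype.card U)) := by
  obtain ⟨i, hi, h⟩ := hD.exists_iterate_step_eq hk π
  obtain ⟨π', v, t, h₁, h₂⟩ := exists_policyIteration_of_iterate h
  exact ⟨π', v, t, h₁, h₂.trans (Nat.mul_le_mul_right _ (Nat.succ_le_succ hi))⟩

end IsContracting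

namespace PolicyIteration

variable {D : DiscountedMDP X U} {π π' : X → U} {v : X → ℝ} {t : ℕ}

theorem value_eq (h : D.PolicyIteration π π' v t) : v = D.value π' := by
  induction h with
  | halt π h => rfl
  | next π π' v t h rest ih => exact ih

theorem step_eq (h : D.PolicyIteration π π' v t) : D.step π' = π' := by
  induction h with
  | halt π h => exact h
  | next π π' v t h rest ih => exact ih

theorem eq_of_step_eq (h : D.PolicyIteration π π' v t) (hπ : D.step π = π) : π' = π := by
  cases h with
  | halt => rfl
  | next _ _ _ _ hne => exact absurd hπ hne

theorem value_le {γ : ℝ} (h : D.PolicyIteration π π' v t) (hD : D.IsContracting γ) (π₁ : X → U)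
    (x : X) : D.value π₁ x ≤ D.value π' x :=
  hD.value_le_of_step_eq h.step_eq π₁ x

/-- The first pass already gives a strict gain somewhere, and the final policy is optimal. -/
theorem value_lt {γ : ℝ} (h : D.PolicyIteration π π' v t) (hD : D.IsContracting γ) (hne : π' ≠ π) :
    ∃ x, D.value π x < D.value π' x := by
  have hπ : D.step π ≠ π := fun e => hne (h.eq_of_step_eq e)
  obtain ⟨x, hx⟩ := hD.value_lt_step π hπ
  exact ⟨x, hx.trans_le (h.value_le hD _ x)⟩

end PolicyIteration

end DiscountedMDP

namespace RemoteControl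

/-! ### The controlled process under a fixed pair of policies -/

section Model

variable {S A : Type} [Fintype S] (M : RemoteControl S A)

theorem sent_zero (c : Bool) : M.sent 0 c = false := by simp [sent]

theorem sent_last (c : Bool) : M.sent (Fin.last M.Tmax) c = true := by
  have h : Fin.last M.Tmax ≠ 0 := by
    have := M.Tmax_pos
    simp [Fin.ext_iff]
    omega
  simp [sent, h]

theorem nextAge_ofNat {k : ℕ} (hk : k < M.Tmax) :
    M.nextAge (Fin.ofNat (M.Tmax + 1) k) = Fin.ofNat (M.Tmax + 1) (k + 1) := by
  have h : (Fin.ofNat (M.Tmax + 1) k).val = k := Nat.mod_eq_of_lt (by omega)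
  rw [nextAge, h, min_eq_left (by omega)]

/-- The encoder's state at the next time step, if the process then is in `s'`. -/
def nextState (z : M.EncState) (c : Bool) (s' : S) : M.EncState :=
  (s', M.nextAge (M.received z c).2, (M.received z c).1)

/-- Age and last received state evolve deterministically, so only the sum over process states
survives. The predicate is a parameter so that its decidability instance can be the classical one or
the computable one. -/
theorem sum_nextState (z : M.EncState) (c : Bool) (p : M.EncState → Prop) [DecidablePred p]
    (hp : ∀ z', p z' ↔ z'.2 = (M.nextAge (M.received z c).2, (M.received z c).1))
    (f : M.EncState → ℝ) :
    ∑ z', (if p z' then f z' else 0) = ∑ s', f (M.nextState z c s') := by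
  classical
  rw [Fintype.sum_prod_type]
  refine Finset.sum_congr rfl fun s' _ => ?_
  rw [Finset.sum_eq_single (M.nextAge (M.received z c).2, (M.received z c).1)]
  · rw [if_pos ((hp _).2 rfl)]
    rfl
  · intro y _ hy
    rw [if_neg fun h => hy ((hp _).1 h)]
  · simp

theorem sum_transition_mul (πe : M.EncoderPolicy) (πd : M.DecoderPolicy) (z : M.EncState)
    (f : M.EncState → ℝ) : ∑ z', M.transition πe πd z z' * f z' =
      ∑ s', M.P z.1 (M.control πd z (πe z)) s' * f (M.nextState z (πe z) s') := by
  classical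
  simp only [transition, ite_mul, zero_mul]
  exact M.sum_nextState z (πe z) _ (fun z' => Iff.rfl)
    fun z' => M.P z.1 (M.control πd z (πe z)) z'.1 * f z'

theorem transition_nonneg (πe : M.EncoderPolicy) (πd : M.DecoderPolicy) (z z' : M.EncState) :
    0 ≤ M.transition πe πd z z' := by
  rw [transition]
  split_ifs
  · exact M.P_nonneg _ _ _
  · exact le_rfl

theorem stateProb_nonneg (πe : M.EncoderPolicy) (πd : M.DecoderPolicy) (s₀ : S) (t : ℕ)
    (z : M.EncState) : 0 ≤ M.stateProb πe πd s₀ t z := by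
  induction t generalizing z with
  | zero =>
    rw [stateProb]
    split_ifs <;> simp
  | succ t ih =>
    rw [stateProb]
    exact Finset.sum_nonneg fun y _ => mul_nonneg (ih y) (M.transition_nonneg _ _ _ _)

/-- Expectations at time `t + 1` are pulled back by one step of the chain. -/
theorem sum_stateProb_succ_mul (πe : M.EncoderPolicy) (πd : M.DecoderPolicy) (s₀ : S) (t : ℕ)
    (f : M.EncState → ℝ) : ∑ z, M.stateProb πe πd s₀ (t + 1) z * f z =
      ∑ z, M.stateProb πe πd s₀ t z *
        ∑ s', M.P z.1 (M.control πd z (πe z)) s' * f (M.nextState z (πe z) s') := by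
  simp only [stateProb, Finset.sum_mul]
  rw [Finset.sum_comm]
  refine Finset.sum_congr rfl fun z _ => ?_
  rw [← M.sum_transition_mul, Finset.mul_sum]
  exact Finset.sum_congr rfl fun y _ => mul_assoc _ _ _

theorem sum_stateProb_zero_mul (πe : M.EncoderPolicy) (πd : M.DecoderPolicy) (s₀ : S)
    (f : M.EncState → ℝ) : ∑ z, M.stateProb πe πd s₀ 0 z * f z = f (s₀, 0, s₀) := by
  classical
  rw [Finset.sum_eq_single (s₀, 0, s₀)]
  · simp [stateProb]
  · intro z _ hz
    simp [stateProb, hz]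
  · simp

theorem sum_stateProb (πe : M.EncoderPolicy) (πd : M.DecoderPolicy) (s₀ : S) (t : ℕ) :
    ∑ z, M.stateProb πe πd s₀ t z = 1 := by
  induction t with
  | zero => simpa using M.sum_stateProb_zero_mul πe πd s₀ fun _ => 1
  | succ t ih => simpa [M.P_sum, ih] using M.sum_stateProb_succ_mul πe πd s₀ t fun _ => 1

theorem abs_sum_stateProb_mul_le (πe : M.EncoderPolicy) (πd : M.DecoderPolicy) (s₀ : S) (t : ℕ)
    {f : M.EncState → ℝ} {c : ℝ} (hf : ∀ z, |f z| ≤ c) :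
    |∑ z, M.stateProb πe πd s₀ t z * f z| ≤ c := by
  calc |∑ z, M.stateProb πe πd s₀ t z * f z|
      ≤ ∑ z, |M.stateProb πe πd s₀ t z * f z| := Finset.abs_sum_le_sum_abs _ _
    _ ≤ ∑ z, M.stateProb πe πd s₀ t z * c := Finset.sum_le_sum fun z _ => by
        rw [abs_mul, abs_of_nonneg (M.stateProb_nonneg _ _ _ _ _)]
        exact mul_le_mul_of_nonneg_left (hf z) (M.stateProb_nonneg _ _ _ _ _)
    _ = c := by rw [← Finset.sum_mul, M.sum_stateProb, one_mul]

theorem abs_stageReward_le {B : ℝ} (hr : ∀ s a s', |M.r s a s'| ≤ B) (hβ : M.β ≤ B)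
    (πe : M.EncoderPolicy) (πd : M.DecoderPolicy) (z : M.EncState) :
    |M.stageReward πe πd z| ≤ 2 * B := by
  have h₁ : |∑ s', M.P z.1 (M.control πd z (πe z)) s' * M.r z.1 (M.control πd z (πe z)) s'| ≤ B := by
    calc _ ≤ ∑ s', |M.P z.1 (M.control πd z (πe z)) s' * M.r z.1 (M.control πd z (πe z)) s'| :=
          Finset.abs_sum_le_sum_abs _ _
      _ ≤ ∑ s', M.P z.1 (M.control πd z (πe z)) s' * B := Finset.sum_le_sum fun s' _ => by
          rw [abs_mul, abs_of_nonneg (M.P_nonneg _ _ _)]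
          exact mul_le_mul_of_nonneg_left (hr _ _ _) (M.P_nonneg _ _ _)
      _ = B := by rw [← Finset.sum_mul, M.P_sum, one_mul]
  have hβ₀ := M.β_nonneg
  have h₂ := abs_le.1 h₁
  rw [stageReward, abs_le]
  split_ifs <;> constructor <;> linarith

theorem abs_longTermReward_le {B : ℝ} (hr : ∀ s a s', |M.r s a s'| ≤ B) (hβ : M.β ≤ B)
    (πe : M.EncoderPolicy) (πd : M.DecoderPolicy) (s : S) :
    |M.longTermReward πe πd s| ≤ 2 * B / (1 - M.γ) := by
  have h := (hasSum_geometric_of_lt_one M.γ_nonneg M.γ_lt_one).mul_right (2 * B)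
  rw [inv_mul_eq_div] at h
  rw [longTermReward, ← Real.norm_eq_abs]
  refine tsum_of_norm_bounded h fun t => ?_
  rw [Real.norm_eq_abs, abs_mul, abs_of_nonneg (pow_nonneg M.γ_nonneg t)]
  exact mul_le_mul_of_nonneg_left
    (M.abs_sum_stateProb_mul_le πe πd s t (M.abs_stageReward_le hr hβ πe πd))
    (pow_nonneg M.γ_nonneg t)

/-- The long-term reward is given by any solution of the encoder's evaluation equations. -/
theorem longTermReward_eq {πe : M.EncoderPolicy} {πd : M.DecoderPolicy} {w : M.EncState → ℝ}
    (hw : ∀ z, w z = M.stageReward πe πd z +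
      M.γ * ∑ s', M.P z.1 (M.control πd z (πe z)) s' * w (M.nextState z (πe z) s')) (s : S) :
    M.longTermReward πe πd s = w (s, 0, s) := by
  obtain ⟨c, hc⟩ := Finite.exists_le fun z => |M.stageReward πe πd z|
  obtain ⟨c', hc'⟩ := Finite.exists_le fun z => |w z|
  have hsum : Summable fun t : ℕ =>
      M.γ ^ t * ∑ z, M.stateProb πe πd s t z * M.stageReward πe πd z := by
    refine Summable.of_norm_bounded
      ((summable_geometric_of_lt_one M.γ_nonneg M.γ_lt_one).mul_right c) fun t => ?_
    rw [Real.norm_eq_abs, abs_mul, abs_of_nonneg (pow_nonneg M.γ_nonneg t)]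
    exact mul_le_mul_of_nonneg_left (M.abs_sum_stateProb_mul_le πe πd s t hc)
      (pow_nonneg M.γ_nonneg t)
  -- The evaluation equation turns each stage reward into a difference of expectations of `w`, so
  -- the discounted sum telescopes to `w (s, 0, s)` minus a vanishing remainder.
  have hstep : ∀ t, ∑ z, M.stateProb πe πd s t z * M.stageReward πe πd z =
      ∑ z, M.stateProb πe πd s t z * w z - M.γ * ∑ z, M.stateProb πe πd s (t + 1) z * w z := by
    intro t
    rw [M.sum_stateProb_succ_mul, Finset.mul_sum, ← Finset.sum_sub_distrib]
    refine Finset.sum_congr rfl fun z _ => ?_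
    nth_rewrite 1 [hw z]
    ring
  have hpartial : ∀ n, ∑ t ∈ Finset.range n,
      M.γ ^ t * ∑ z, M.stateProb πe πd s t z * M.stageReward πe πd z =
        w (s, 0, s) - M.γ ^ n * ∑ z, M.stateProb πe πd s n z * w z := by
    intro n
    induction n with
    | zero => simp [M.sum_stateProb_zero_mul]
    | succ n ih =>
      rw [Finset.sum_range_succ, ih, hstep]
      ring
  have hlim : Filter.Tendsto (fun n => M.γ ^ n * ∑ z, M.stateProb πe πd s n z * w z)
      Filter.atTop (nhds 0) := by
    refine squeeze_zero_norm (a := fun n => M.γ ^ n * c') (fun n => ?_) ?_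
    · rw [Real.norm_eq_abs, abs_mul, abs_of_nonneg (pow_nonneg M.γ_nonneg n)]
      exact mul_le_mul_of_nonneg_left (M.abs_sum_stateProb_mul_le πe πd s n hc')
        (pow_nonneg M.γ_nonneg n)
    · simpa using (tendsto_pow_atTop_nhds_zero_of_lt_one M.γ_nonneg M.γ_lt_one).mul_const c'
  refine tendsto_nhds_unique hsum.hasSum.tendsto_sum_nat ?_
  simp only [hpartial]
  simpa using hlim.const_sub (w (s, 0, s))

theorem payoff_le_add {ξ : S → ℝ} (hξ : ξ ∈ stdSimplex ℝ S) {πe πe' : M.EncoderPolicy}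
    {πd πd' : M.DecoderPolicy} {ε : ℝ}
    (h : ∀ s, M.longTermReward πe πd s ≤ M.longTermReward πe' πd' s + ε) :
    M.payoff ξ πe πd ≤ M.payoff ξ πe' πd' + ε := by
  calc M.payoff ξ πe πd ≤ ∑ s, ξ s * (M.longTermReward πe' πd' s + ε) :=
        Finset.sum_le_sum fun s _ => mul_le_mul_of_nonneg_left (h s) (hξ.1 s)
    _ = M.payoff ξ πe' πd' + ε := by
        simp only [mul_add, Finset.sum_add_distrib, ← Finset.sum_mul, hξ.2, one_mul, payoff]

theorem payoff_le {ξ : S → ℝ} (hξ : ξ ∈ stdSimplex ℝ S) {πe πe' : M.EncoderPolicy}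
    {πd πd' : M.DecoderPolicy}
    (h : ∀ s, M.longTermReward πe πd s ≤ M.longTermReward πe' πd' s) :
    M.payoff ξ πe πd ≤ M.payoff ξ πe' πd' :=
  Finset.sum_le_sum fun s _ => mul_le_mul_of_nonneg_left (h s) (hξ.1 s)

end Model

/-! ### The two agents' decision problems have the same values -/

section Algorithm

variable {S A : Type} [FinEnum S] [FinEnum A] (M : RemoteControl S A)

theorem encoderMDP_rew (πd : M.DecoderPolicy) (z : M.EncState) (c : Bool) :
    (M.encoderMDP πd).val.rew z c =
      ∑ s', M.P z.1 (M.control πd z c) s' * M.r z.1 (M.control πd z c) s'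
        - if M.sent z.2.1 c then M.β else 0 := by
  simp only [encoderMDP, Timed.bind_val, Timed.pure_val, Timed.tabulate_val]
  split_ifs <;> simp

theorem encoderMDP_ker (πd : M.DecoderPolicy) (z : M.EncState) (c : Bool) (z' : M.EncState) :
    (M.encoderMDP πd).val.ker z c z' =
      if z'.2 = (M.nextAge (M.received z c).2, (M.received z c).1) then
        M.γ * M.P z.1 (M.control πd z c) z'.1 else 0 := by
  simp only [encoderMDP, Timed.bind_val, Timed.pure_val, Timed.tabulate_val]
  split_ifs <;> simp

theorem sum_encoderMDP_ker_mul (πd : M.DecoderPolicy) (z : M.EncState) (c : Bool)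
    (f : M.EncState → ℝ) : ∑ z', (M.encoderMDP πd).val.ker z c z' * f z' =
      M.γ * ∑ s', M.P z.1 (M.control πd z c) s' * f (M.nextState z c s') := by
  simp only [encoderMDP_ker, ite_mul, zero_mul]
  rw [Finset.mul_sum]
  refine (M.sum_nextState z c _ (fun z' => Iff.rfl)
    fun z' => M.γ * M.P z.1 (M.control πd z c) z'.1 * f z').trans ?_
  exact Finset.sum_congr rfl fun s' _ => mul_assoc _ _ _

theorem encoderMDP_isContracting (πd : M.DecoderPolicy) :
    (M.encoderMDP πd).val.IsContracting M.γ where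
  nonneg := M.γ_nonneg
  lt_one := M.γ_lt_one
  ker_nonneg z c z' := by
    rw [encoderMDP_ker]
    split_ifs
    · exact mul_nonneg M.γ_nonneg (M.P_nonneg _ _ _)
    · exact le_rfl
  ker_sum_le z c := by
    have h := M.sum_encoderMDP_ker_mul πd z c fun _ => 1
    simp only [mul_one, M.P_sum] at h
    exact h.le

/-- Value of the encoder's state under a pair of policies. -/
noncomputable def encoderValue (πe : M.EncoderPolicy) (πd : M.DecoderPolicy) : M.EncState → ℝ :=
  (M.encoderMDP πd).val.value πe

theorem encoderValue_eq (πe : M.EncoderPolicy) (πd : M.DecoderPolicy) (z : M.EncState) :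
    M.encoderValue πe πd z = M.stageReward πe πd z + M.γ *
      ∑ s', M.P z.1 (M.control πd z (πe z)) s' *
        M.encoderValue πe πd (M.nextState z (πe z) s') := by
  refine ((M.encoderMDP_isContracting πd).value_eq πe z).trans ?_
  rw [DiscountedMDP.actionValue, M.sum_encoderMDP_ker_mul, M.encoderMDP_rew]
  rfl

theorem longTermReward_eq_encoderValue (πe : M.EncoderPolicy) (πd : M.DecoderPolicy) (s : S) :
    M.longTermReward πe πd s = M.encoderValue πe πd (s, 0, s) :=
  M.longTermReward_eq (M.encoderValue_eq πe πd) s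

theorem encoderValue_of_not_sent {πe : M.EncoderPolicy} (πd : M.DecoderPolicy) {s l : S} {Δ : M.Age}
    (h : M.sent Δ (πe (s, Δ, l)) = false) : M.encoderValue πe πd (s, Δ, l) =
      ∑ s', M.P s (πd l Δ) s' * M.r s (πd l Δ) s' +
        M.γ * ∑ s', M.P s (πd l Δ) s' * M.encoderValue πe πd (s', M.nextAge Δ, l) := by
  rw [encoderValue_eq]
  simp [stageReward, control, nextState, received, h]

/-- Apart from the price `β`, a transmission acts like age `0` with `s` received: nothing is sent at
age `0`, so control and successor states coincide. -/
theorem encoderValue_of_sent {πe : M.EncoderPolicy} (πd : M.DecoderPolicy) {s l : S} {Δ : M.Age}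
    (h : M.sent Δ (πe (s, Δ, l)) = true) :
    M.encoderValue πe πd (s, Δ, l) = M.encoderValue πe πd (s, 0, s) - M.β := by
  rw [M.encoderValue_of_not_sent πd (M.sent_zero _), encoderValue_eq]
  simp [stageReward, control, nextState, received, h]
  ring

section Episode

variable (πe : M.EncoderPolicy) (l : S) (a : M.Age → A) (k : ℕ)

/-- Discounted probability of the state at age `k + 1`, before the encoder's decision. -/
noncomputable def prior (s' : S) : ℝ :=
  M.γ * ∑ s, (M.episode πe l a k).val.belief s * M.P s (a (Fin.ofNat (M.Tmax + 1) k)) s'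

theorem episode_succ_belief (s' : S) : (M.episode πe l a (k + 1)).val.belief s' =
    if M.sent (Fin.ofNat (M.Tmax + 1) (k + 1)) (πe (s', Fin.ofNat (M.Tmax + 1) (k + 1), l))
      then 0 else M.prior πe l a k s' := rfl

theorem episode_succ_ker (s' : S) : (M.episode πe l a (k + 1)).val.ker s' =
    (M.episode πe l a k).val.ker s' +
      if M.sent (Fin.ofNat (M.Tmax + 1) (k + 1)) (πe (s', Fin.ofNat (M.Tmax + 1) (k + 1), l))
        then M.prior πe l a k s' else 0 := by
  simp only [episode, Timed.bind_val, Timed.pure_val, Timed.tabulate_val]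
  split_ifs <;> simp [prior]

theorem episode_succ_rew : (M.episode πe l a (k + 1)).val.rew =
    (M.episode πe l a k).val.rew +
      ∑ s, (M.episode πe l a k).val.belief s * ∑ s', M.P s (a (Fin.ofNat (M.Tmax + 1) k)) s' *
        M.r s (a (Fin.ofNat (M.Tmax + 1) k)) s' -
      ∑ s', if M.sent (Fin.ofNat (M.Tmax + 1) (k + 1)) (πe (s', Fin.ofNat (M.Tmax + 1) (k + 1), l))
        then M.β * M.prior πe l a k s' else 0 := by
  simp only [episode, Timed.bind_val, Timed.pure_val, Timed.tabulate_val, Timed.add_val,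
    Timed.sub_val, Timed.total_val, Timed.mul_val]
  congr 1
  refine Finset.sum_congr rfl fun s' _ => ?_
  split_ifs <;> simp [prior]

theorem sum_prior_mul (f : S → ℝ) : ∑ s', M.prior πe l a k s' * f s' =
    ∑ s, (M.episode πe l a k).val.belief s *
      (M.γ * ∑ s', M.P s (a (Fin.ofNat (M.Tmax + 1) k)) s' * f s') := by
  simp only [prior, Finset.mul_sum, Finset.sum_mul]
  rw [Finset.sum_comm]
  exact Finset.sum_congr rfl fun s _ => Finset.sum_congr rfl fun s' _ => by ring

theorem episode_nonneg (s : S) :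
    0 ≤ (M.episode πe l a k).val.belief s ∧ 0 ≤ (M.episode πe l a k).val.ker s := by
  induction k generalizing s with
  | zero =>
    refine ⟨?_, le_rfl⟩
    change 0 ≤ if s = l then (1 : ℝ) else 0
    split_ifs <;> simp
  | succ k ih =>
    have h : 0 ≤ M.prior πe l a k s := mul_nonneg M.γ_nonneg
      (Finset.sum_nonneg fun s _ => mul_nonneg (ih s).1 (M.P_nonneg _ _ _))
    rw [episode_succ_belief, episode_succ_ker]
    have := (ih s).2
    split_ifs
    · exact ⟨le_rfl, by linarith⟩
    · exact ⟨h, by linarith⟩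

/-- Each step multiplies the belief mass by `γ` and moves part of it to the kernel, whose mass is
kept. The initial mass is `1`, so the bound `γ` starts only after one step. -/
theorem episode_sum_le : ∑ s, ((M.episode πe l a (k + 1)).val.belief s +
    (M.episode πe l a (k + 1)).val.ker s) ≤ M.γ := by
  have hstep : ∀ k, ∑ s, ((M.episode πe l a (k + 1)).val.belief s +
      (M.episode πe l a (k + 1)).val.ker s) =
        M.γ * ∑ s, (M.episode πe l a k).val.belief s + ∑ s, (M.episode πe l a k).val.ker s := by
    intro k
    have h := M.sum_prior_mul πe l a k fun _ => 1
    simp only [mul_one, M.P_sum, ← Finset.sum_mul] at h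
    rw [mul_comm M.γ, ← h, ← Finset.sum_add_distrib]
    refine Finset.sum_congr rfl fun s _ => ?_
    rw [episode_succ_belief, episode_succ_ker]
    split_ifs <;> ring
  induction k with
  | zero =>
    rw [hstep]
    have h₁ : ∀ s, (M.episode πe l a 0).val.belief s = if s = l then 1 else 0 := fun _ => rfl
    have h₂ : ∀ s, (M.episode πe l a 0).val.ker s = 0 := fun _ => rfl
    simp [h₁, h₂]
  | succ k ih =>
    rw [hstep]
    rw [Finset.sum_add_distrib] at ih
    have h : 0 ≤ ∑ s, (M.episode πe l a (k + 1)).val.belief s :=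
      Finset.sum_nonneg fun s _ => (M.episode_nonneg πe l a (k + 1) s).1
    have := mul_le_mul_of_nonneg_right M.γ_lt_one.le h
    linarith

variable {πe l k} in
-- The belief is recorded after the encoder's decision, so silence has already excluded these
-- states; at age `0` the hypothesis is impossible.
theorem belief_eq_zero_of_sent {s : S}
    (h : M.sent (Fin.ofNat (M.Tmax + 1) k) (πe (s, Fin.ofNat (M.Tmax + 1) k, l)) = true) :
    (M.episode πe l a k).val.belief s = 0 := by
  cases k with
  | zero => exact absurd ((M.sent_zero _).symm.trans h) (by simp)
  | succ k => rw [episode_succ_belief, if_pos h]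

end Episode

/-- Decomposition of the value at a transmission along the episode that follows it. -/
theorem encoderValue_eq_episode (πe : M.EncoderPolicy) (πd : M.DecoderPolicy) (l : S) {k : ℕ}
    (hk : k ≤ M.Tmax) : M.encoderValue πe πd (l, 0, l) =
      (M.episode πe l (πd l) k).val.rew +
        ∑ s, (M.episode πe l (πd l) k).val.belief s *
          M.encoderValue πe πd (s, Fin.ofNat (M.Tmax + 1) k, l) +
        ∑ s, (M.episode πe l (πd l) k).val.ker s * M.encoderValue πe πd (s, 0, s) := by
  induction k with
  | zero =>
    have h₁ : ∀ s, (M.episode πe l (πd l) 0).val.belief s = if s = l then 1 else 0 := fun _ => rfl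
    have h₂ : ∀ s, (M.episode πe l (πd l) 0).val.ker s = 0 := fun _ => rfl
    have h₃ : (M.episode πe l (πd l) 0).val.rew = 0 := rfl
    simp [h₁, h₂, h₃]
  | succ k ih =>
    have h₁ : ∑ s, (M.episode πe l (πd l) k).val.belief s *
          M.encoderValue πe πd (s, Fin.ofNat (M.Tmax + 1) k, l) =
        ∑ s, (M.episode πe l (πd l) k).val.belief s *
          ∑ s', M.P s (πd l (Fin.ofNat (M.Tmax + 1) k)) s' *
            M.r s (πd l (Fin.ofNat (M.Tmax + 1) k)) s' +
        ∑ s', M.prior πe l (πd l) k s' *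
          M.encoderValue πe πd (s', Fin.ofNat (M.Tmax + 1) (k + 1), l) := by
      rw [M.sum_prior_mul, ← Finset.sum_add_distrib]
      refine Finset.sum_congr rfl fun s _ => ?_
      -- Sending states carry no belief, so the one-step equation is needed only for silent ones.
      cases h : M.sent (Fin.ofNat (M.Tmax + 1) k) (πe (s, Fin.ofNat (M.Tmax + 1) k, l)) with
      | true => simp [M.belief_eq_zero_of_sent (πd l) h]
      | false =>
        rw [M.encoderValue_of_not_sent πd h, M.nextAge_ofNat (by omega)]
        ring
    -- The prior mass splits into what leaves through a transmission, paying `β`, and what stays in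
    -- the belief.
    have h₂ : ∑ s', M.prior πe l (πd l) k s' *
          M.encoderValue πe πd (s', Fin.ofNat (M.Tmax + 1) (k + 1), l) +
        ∑ s, (M.episode πe l (πd l) k).val.ker s * M.encoderValue πe πd (s, 0, s) =
        ∑ s, (M.episode πe l (πd l) (k + 1)).val.belief s *
          M.encoderValue πe πd (s, Fin.ofNat (M.Tmax + 1) (k + 1), l) +
        ∑ s, (M.episode πe l (πd l) (k + 1)).val.ker s * M.encoderValue πe πd (s, 0, s) -
        ∑ s', if M.sent (Fin.ofNat (M.Tmax + 1) (k + 1))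
            (πe (s', Fin.ofNat (M.Tmax + 1) (k + 1), l))
          then M.β * M.prior πe l (πd l) k s' else 0 := by
      rw [← Finset.sum_add_distrib, ← Finset.sum_add_distrib, ← Finset.sum_sub_distrib]
      refine Finset.sum_congr rfl fun s _ => ?_
      rw [episode_succ_belief, episode_succ_ker]
      split_ifs with h
      · rw [M.encoderValue_of_sent πd h]
        ring
      · ring
    rw [ih (by omega), h₁, episode_succ_rew]
    linarith

/-- As `Tmax ≥ 1`, at least one discounted step precedes the next transmission. -/
theorem decoderMDP_isContracting (πe : M.EncoderPolicy) :
    (M.decoderMDP πe).val.IsContracting M.γ where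
  nonneg := M.γ_nonneg
  lt_one := M.γ_lt_one
  ker_nonneg l a s := (M.episode_nonneg πe l a M.Tmax s).2
  ker_sum_le l a := by
    obtain ⟨k, hk⟩ : ∃ k, M.Tmax = k + 1 := ⟨_, (Nat.sub_add_cancel M.Tmax_pos).symm⟩
    have h := M.episode_sum_le πe l a k
    rw [← hk] at h
    refine le_trans (Finset.sum_le_sum fun s _ => ?_) h
    exact le_add_of_nonneg_left (M.episode_nonneg πe l a M.Tmax s).1

/-- At age `Tmax` the forced transmission empties the belief, and the episode decomposition becomes
the decoder's evaluation equation. -/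
theorem longTermReward_eq_decoderValue (πe : M.EncoderPolicy) (πd : M.DecoderPolicy) (l : S) :
    M.longTermReward πe πd l = (M.decoderMDP πe).val.value πd l := by
  refine (M.decoderMDP_isContracting πe).eq_value (w := M.longTermReward πe πd) (fun l => ?_) l
  have h := M.encoderValue_eq_episode πe πd l le_rfl
  have hz : ∀ s, (M.episode πe l (πd l) M.Tmax).val.belief s = 0 := fun s =>
    M.belief_eq_zero_of_sent (πd l) (by
      have e : Fin.ofNat (M.Tmax + 1) M.Tmax = Fin.last M.Tmax :=
        Fin.ext (Nat.mod_eq_of_lt (Nat.lt_succ_self _))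
      rw [e]
      exact M.sent_last _)
  simp only [hz, zero_mul, Finset.sum_const_zero, add_zero] at h
  rw [show M.longTermReward πe πd = fun s => M.encoderValue πe πd (s, 0, s) from
    funext (M.longTermReward_eq_encoderValue πe πd)]
  exact h

end Algorithm

end RemoteControl

namespace RemoteControl

/-! ### Polynomial time bound for a round -/

section Algorithm

variable {S A : Type} [FinEnum S] [FinEnum A] (M : RemoteControl S A)

theorem card_encState :
    Fintype.card M.EncState = Fintype.card S * ((M.Tmax + 1) * Fintype.card S) := by
  simp only [← Nat.card_eq_fintype_card, Nat.card_prod, Nat.card_fin]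

theorem card_actionSequence [Fintype (M.Age → A)] :
    Fintype.card (M.Age → A) = Fintype.card A ^ (M.Tmax + 1) := by
  simp only [← Nat.card_eq_fintype_card, Nat.card_fun, Nat.card_fin]

theorem encoderMDP_time_le (πd : M.DecoderPolicy) : (M.encoderMDP πd).time ≤
    Fintype.card M.EncState * (2 * (Fintype.card S * 2 + 2) + 1) +
      Fintype.card M.EncState * (2 * (Fintype.card M.EncState * 2 + 1) + 1) := by
  simp only [encoderMDP, Timed.bind_time, Timed.pure_time, add_zero]
  rw [← Fintype.card_bool]
  refine Nat.add_le_add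
    (Timed.tabulate_time_le fun z => Timed.tabulate_time_le (c := Fintype.card S * 2 + 1) fun c => ?_)
    (Timed.tabulate_time_le fun z => Timed.tabulate_time_le fun c => Timed.tabulate_time_le fun z' => ?_)
  · simp only [Timed.bind_time]
    refine Nat.add_le_add (Timed.total_time_le fun s' => by simp) ?_
    split_ifs <;> simp
  · split_ifs <;> simp

theorem episode_time_le (πe : M.EncoderPolicy) (l : S) (a : M.Age → A) (k : ℕ) :
    (M.episode πe l a k).time ≤ 15 * Fintype.card S ^ 2 * (k + 1) := by
  have hS : 0 < Fintype.card S := Fintype.card_pos_iff.2 ⟨l⟩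
  have hsq : Fintype.card S ≤ Fintype.card S ^ 2 := Nat.le_self_pow (by norm_num) _
  induction k with
  | zero =>
    have h : (M.episode πe l a 0).time ≤ Fintype.card S * 1 + Fintype.card S * 1 := by
      simp only [episode, Timed.bind_time, Timed.pure_time, add_zero]
      exact Nat.add_le_add (Timed.tabulate_time_le fun _ => le_rfl)
        (Timed.tabulate_time_le fun _ => le_rfl)
    omega
  | succ k ih =>
    have h : (M.episode πe l a (k + 1)).time ≤ (M.episode πe l a k).time +
        (Fintype.card S * (Fintype.card S * 2 + 2) + (Fintype.card S * (Fintype.card S * 2 + 2) +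
          (Fintype.card S * 2 + (1 + (1 + (Fintype.card S * 2 + Fintype.card S * 1)))))) := by
      simp only [episode, Timed.bind_time, Timed.pure_time, Timed.add_time, Timed.sub_time, add_zero]
      refine Nat.add_le_add le_rfl (Nat.add_le_add
        (Timed.total_time_le (c := Fintype.card S * 2 + 1) fun s => ?_) (Nat.add_le_add
        (Timed.tabulate_time_le (c := Fintype.card S * 2 + 1) fun s' => ?_) (Nat.add_le_add
        (Timed.total_time_le fun s' => ?_) (Nat.add_le_add le_rfl (Nat.add_le_add le_rfl
        (Nat.add_le_add (Timed.tabulate_time_le fun s' => ?_)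
          (Timed.tabulate_time_le fun s' => ?_)))))))
      · exact Nat.add_le_add (Timed.total_time_le fun s' => by simp) le_rfl
      · exact Nat.add_le_add (Timed.total_time_le fun s' => by simp) le_rfl
      · split_ifs <;> simp
      · split_ifs <;> simp
      · simp
    -- With `N` states, one further age costs `4N² + 9N + 2 ≤ 15N²`.
    refine h.trans ((Nat.add_le_add_right ih _).trans ?_)
    nlinarith

theorem decoderMDP_time_le (πe : M.EncoderPolicy) : (M.decoderMDP πe).time ≤
    Fintype.card S * (Fintype.card A ^ (M.Tmax + 1) *
      (15 * Fintype.card S ^ 2 * (M.Tmax + 1) + 1) + 1) := by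
  simp only [decoderMDP, Timed.bind_time, Timed.pure_time, add_zero]
  rw [← M.card_actionSequence]
  exact Timed.tabulate_time_le fun l => Timed.tabulate_time_le fun a => M.episode_time_le πe l a _

/-- Coefficient of the bound on the time of a round, if `γ ^ k < 1 - γ`. -/
def roundCoeff (T k : ℕ) : ℕ :=
  17 * (T + 1) + 21 * (k + 1) + (16 * (T + 1) ^ 2 + 42 * (2 * k + 1) * (T + 1) ^ 4) + 2 * (T + 1)

variable [Nonempty S] [Nonempty A]

/-- With `y = |A| * |S|`, policy iteration contributes order `y ^ (2 * T + 6)` for the decoder and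
`y ^ 8` for the encoder; the common exponent covers both. The two bounds include the halting tests
of the exact and of the tolerant algorithm. -/
theorem exists_round_time_le {k : ℕ} (hk : M.γ ^ k < 1 - M.γ) (πe : M.EncoderPolicy)
    (πd : M.DecoderPolicy) : ∃ πe' πd' vd ve t, M.Round πe πd πe' πd' vd ve t ∧
      t + M.profileSize ≤
        roundCoeff M.Tmax k * (Fintype.card A * Fintype.card S) ^ (2 * M.Tmax + 8) ∧
      t + 2 * Fintype.card S ≤
        roundCoeff M.Tmax k * (Fintype.card A * Fintype.card S) ^ (2 * M.Tmax + 8) := by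
  obtain ⟨πd', vd, t₁, h₁, ht₁⟩ :=
    (M.decoderMDP_isContracting πe).exists_policyIteration hk πd
  obtain ⟨πe', ve, t₂, h₂, ht₂⟩ :=
    (M.encoderMDP_isContracting πd').exists_policyIteration hk πe
  refine ⟨πe', πd', vd, ve, _, ⟨_, _, ⟨_, h₁, rfl⟩, ⟨_, h₂, rfl⟩, rfl⟩, ?_⟩
  have htd := M.decoderMDP_time_le πe
  have hte := M.encoderMDP_time_le πd'
  rw [card_actionSequence] at ht₁
  rw [Fintype.card_bool] at ht₂
  have hprof : M.profileSize = Fintype.card M.EncState + Fintype.card S * (M.Tmax + 1) := by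
    simp only [profileSize, Fintype.card_prod, Fintype.card_fin]
  have hn := M.card_encState
  have hN : 0 < Fintype.card S := Fintype.card_pos
  have hA : 0 < Fintype.card A := Fintype.card_pos
  set N := Fintype.card S
  set y := Fintype.card A * N with hy
  set n := Fintype.card M.EncState
  set T := M.Tmax
  set U := Fintype.card A ^ (T + 1)
  have hy1 : 1 ≤ y := Nat.mul_pos hA hN
  have hNy : N ≤ y := Nat.le_mul_of_pos_left _ hA
  have hAy : Fintype.card A ≤ y := Nat.le_mul_of_pos_right _ hN
  have hU : U ≤ y ^ (T + 1) := Nat.pow_le_pow_left hAy _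
  have hny : n ≤ (T + 1) * y ^ 2 := by
    rw [hn]
    calc N * ((T + 1) * N) = (T + 1) * N ^ 2 := by ring
      _ ≤ (T + 1) * y ^ 2 := Nat.mul_le_mul_left _ (Nat.pow_le_pow_left hNy 2)
  have hpow : ∀ {i : ℕ}, i ≤ 2 * T + 8 → y ^ i ≤ y ^ (2 * T + 8) :=
    fun h => Nat.pow_le_pow_right hy1 h
  have hone : ∀ i : ℕ, 1 ≤ y ^ i := fun i => Nat.one_le_pow _ _ hy1
  have b₁ : (M.decoderMDP πe).time ≤ 17 * (T + 1) * y ^ (2 * T + 8) := by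
    calc (M.decoderMDP πe).time ≤ N * (U * (15 * N ^ 2 * (T + 1) + 1) + 1) := htd
      _ ≤ y * (y ^ (T + 1) * (15 * y ^ 2 * (T + 1) + y ^ 2 * (T + 1)) +
            y ^ (T + 1) * (y ^ 2 * (T + 1))) := by
          gcongr
          · exact Nat.mul_pos (hone 2) (Nat.succ_pos T)
          · exact Nat.mul_pos (hone (T + 1)) (Nat.mul_pos (hone 2) (Nat.succ_pos T))
      _ = 17 * (T + 1) * y ^ (T + 4) := by ring
      _ ≤ _ := Nat.mul_le_mul_left _ (hpow (by omega))
  have b₂ : (N * U * k + 1) * (21 * (N ^ 3 * U)) ≤ 21 * (k + 1) * y ^ (2 * T + 8) := by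
    calc (N * U * k + 1) * (21 * (N ^ 3 * U))
        ≤ (y * y ^ (T + 1) * k + y * y ^ (T + 1)) * (21 * (y ^ 3 * y ^ (T + 1))) := by
          gcongr
          exact Nat.mul_pos hy1 (hone _)
      _ = 21 * (k + 1) * y ^ (2 * T + 6) := by ring
      _ ≤ _ := Nat.mul_le_mul_left _ (hpow (by omega))
  have b₃ : (M.encoderMDP πd').time ≤ 16 * (T + 1) ^ 2 * y ^ (2 * T + 8) := by
    have hTy : 1 ≤ (T + 1) * y := Nat.mul_pos (Nat.succ_pos T) hy1
    have hTy2 : 1 ≤ (T + 1) * y ^ 2 := Nat.mul_pos (Nat.succ_pos T) (hone 2)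
    have hy2 : y ≤ (T + 1) * y ^ 2 :=
      (Nat.le_self_pow (by norm_num) y).trans (Nat.le_mul_of_pos_left _ (Nat.succ_pos T))
    calc (M.encoderMDP πd').time
        ≤ n * (2 * (N * 2 + 2) + 1) + n * (2 * (n * 2 + 1) + 1) := hte
      _ ≤ (T + 1) * y ^ 2 * (2 * ((T + 1) * y ^ 2 * 2 + 2 * ((T + 1) * y ^ 2)) + (T + 1) * y ^ 2) +
          (T + 1) * y ^ 2 * (2 * ((T + 1) * y ^ 2 * 2 + (T + 1) * y ^ 2) + (T + 1) * y ^ 2) := by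
          have hN2 : N ≤ (T + 1) * y ^ 2 := hNy.trans hy2
          gcongr
          omega
      _ = 16 * (T + 1) ^ 2 * y ^ 4 := by ring
      _ ≤ _ := Nat.mul_le_mul_left _ (hpow (by omega))
  have b₄ : (n * 2 * k + 1) * (21 * (n ^ 3 * 2)) ≤
      42 * (2 * k + 1) * (T + 1) ^ 4 * y ^ (2 * T + 8) := by
    have hTy2 : 1 ≤ (T + 1) * y ^ 2 := Nat.mul_pos (Nat.succ_pos T) (hone 2)
    calc (n * 2 * k + 1) * (21 * (n ^ 3 * 2))
        ≤ ((T + 1) * y ^ 2 * 2 * k + (T + 1) * y ^ 2) * (21 * (((T + 1) * y ^ 2) ^ 3 * 2)) := by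
          gcongr
      _ = 42 * (2 * k + 1) * (T + 1) ^ 4 * y ^ 8 := by ring
      _ ≤ _ := Nat.mul_le_mul_left _ (hpow (by omega))
  have b₅ : M.profileSize ≤ 2 * (T + 1) * y ^ (2 * T + 8) := by
    have h₁ : N * (T + 1) ≤ (T + 1) * y ^ 2 := by
      rw [mul_comm]
      exact Nat.mul_le_mul_left _ (hNy.trans (Nat.le_self_pow (by norm_num) y))
    calc M.profileSize ≤ 2 * (T + 1) * y ^ 2 := by
          rw [hprof, mul_assoc]
          omega
      _ ≤ _ := Nat.mul_le_mul_left _ (hpow (by omega))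
  have b₆ : 2 * N ≤ 2 * (T + 1) * y ^ (2 * T + 8) := by
    have h₁ : N ≤ y ^ (2 * T + 8) := hNy.trans (Nat.le_self_pow (by omega) y)
    exact Nat.mul_le_mul (by omega) h₁
  simp only [roundCoeff, add_mul] at *
  constructor <;> omega

theorem exists_round (πe : M.EncoderPolicy) (πd : M.DecoderPolicy) :
    ∃ πe' πd' vd ve t, M.Round πe πd πe' πd' vd ve t := by
  obtain ⟨k, hk⟩ := exists_pow_lt_of_lt_one (sub_pos.2 M.γ_lt_one) M.γ_lt_one
  obtain ⟨πe', πd', vd, ve, t, h, -⟩ := M.exists_round_time_le hk πe πd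
  exact ⟨πe', πd', vd, ve, t, h⟩

end Algorithm

/-! ### Convergence of the rounds -/

section Convergence

variable {S A : Type} [FinEnum S] [FinEnum A] {M : RemoteControl S A}

/-- The encoder's policy is optimal from every initial state, given the decoder's policy. -/
def EncoderOptimal (M : RemoteControl S A) (πe : M.EncoderPolicy) (πd : M.DecoderPolicy) : Prop :=
  ∀ πe' s, M.longTermReward πe' πd s ≤ M.longTermReward πe πd s

/-- The decoder's policy is optimal from every initial state, given the encoder's policy. -/
def DecoderOptimal (M : RemoteControl S A) (πe : M.EncoderPolicy) (πd : M.DecoderPolicy) : Prop :=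
  ∀ πd' s, M.longTermReward πe πd' s ≤ M.longTermReward πe πd s

theorem EncoderOptimal.isBestResponseE {πe : M.EncoderPolicy} {πd : M.DecoderPolicy}
    (h : M.EncoderOptimal πe πd) {ξ : S → ℝ} (hξ : ξ ∈ stdSimplex ℝ S) :
    (M.game ξ).IsBestResponseE πe πd :=
  fun πe' => M.payoff_le hξ (h πe')

theorem DecoderOptimal.isBestResponseD {πe : M.EncoderPolicy} {πd : M.DecoderPolicy}
    (h : M.DecoderOptimal πe πd) {ξ : S → ℝ} (hξ : ξ ∈ stdSimplex ℝ S) :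
    (M.game ξ).IsBestResponseD πd πe :=
  fun πd' => M.payoff_le hξ (h πd')

namespace Round

variable {πe πe' : M.EncoderPolicy} {πd πd' : M.DecoderPolicy} {vd : S → ℝ} {ve : M.EncState → ℝ}
  {t : ℕ}

theorem decoderOptimal (h : M.Round πe πd πe' πd' vd ve t) : M.DecoderOptimal πe πd' := by
  obtain ⟨t₁, t₂, ⟨t₁', h₁, -⟩, -, -⟩ := h
  intro πd'' s
  simp only [longTermReward_eq_decoderValue]
  exact h₁.value_le (M.decoderMDP_isContracting πe) πd'' s

theorem encoderOptimal (h : M.Round πe πd πe' πd' vd ve t) : M.EncoderOptimal πe' πd' := by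
  obtain ⟨t₁, t₂, -, ⟨t₂', h₂, -⟩, -⟩ := h
  intro πe'' s
  simp only [longTermReward_eq_encoderValue]
  exact h₂.value_le (M.encoderMDP_isContracting πd') πe'' _

theorem value_fst (h : M.Round πe πd πe' πd' vd ve t) (s : S) :
    vd s = M.longTermReward πe πd' s := by
  obtain ⟨t₁, t₂, ⟨t₁', h₁, -⟩, -, -⟩ := h
  rw [longTermReward_eq_decoderValue, h₁.value_eq]

theorem value_snd (h : M.Round πe πd πe' πd' vd ve t) (s : S) :
    ve (s, 0, s) = M.longTermReward πe' πd' s := by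
  obtain ⟨t₁, t₂, -, ⟨t₂', h₂, -⟩, -⟩ := h
  rw [longTermReward_eq_encoderValue, h₂.value_eq]
  rfl

theorem step_eq (h : M.Round πe πd πe' πd' vd ve t) :
    (M.encoderMDP πd').val.step πe' = πe' := by
  obtain ⟨t₁, t₂, -, ⟨t₂', h₂, -⟩, -⟩ := h
  exact h₂.step_eq

theorem eq_of_step_eq (h : M.Round πe πd πe' πd' vd ve t)
    (hs : (M.encoderMDP πd').val.step πe = πe) : πe' = πe := by
  obtain ⟨t₁, t₂, -, ⟨t₂', h₂, -⟩, -⟩ := h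
  exact h₂.eq_of_step_eq hs

theorem exists_lt (h : M.Round πe πd πe' πd' vd ve t) (hne : πd' ≠ πd) :
    ∃ s, M.longTermReward πe πd s < M.longTermReward πe πd' s := by
  obtain ⟨t₁, t₂, ⟨t₁', h₁, -⟩, -, -⟩ := h
  simp only [longTermReward_eq_decoderValue]
  exact h₁.value_lt (M.decoderMDP_isContracting πe) hne

theorem longTermReward_le (h : M.Round πe πd πe' πd' vd ve t) (s : S) :
    M.longTermReward πe πd s ≤ M.longTermReward πe' πd' s :=
  (h.decoderOptimal πd s).trans (h.encoderOptimal πe s)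

end Round

/-- Sum of the long-term rewards from all initial states. -/
noncomputable def totalReward (M : RemoteControl S A) (πe : M.EncoderPolicy)
    (πd : M.DecoderPolicy) : ℝ :=
  ∑ s, M.longTermReward πe πd s

/-- A gain in one initial state survives in the sum because no other state loses. -/
theorem totalReward_add_lt {πe πe' : M.EncoderPolicy} {πd πd' : M.DecoderPolicy} {ε : ℝ} {s : S}
    (h : ∀ s, M.longTermReward πe πd s ≤ M.longTermReward πe' πd' s)
    (hs : M.longTermReward πe πd s + ε < M.longTermReward πe' πd' s) :
    M.totalReward πe πd + ε < M.totalReward πe' πd' := by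
  have h₁ := Finset.single_le_sum
    (f := fun s => M.longTermReward πe' πd' s - M.longTermReward πe πd s)
    (fun s _ => sub_nonneg.2 (h s)) (Finset.mem_univ s)
  simp only [Finset.sum_sub_distrib] at h₁
  simp only [totalReward]
  linarith

theorem abs_totalReward_le {B : ℝ} (hr : ∀ s a s', |M.r s a s'| ≤ B) (hβ : M.β ≤ B)
    (πe : M.EncoderPolicy) (πd : M.DecoderPolicy) :
    |M.totalReward πe πd| ≤ Fintype.card S * (2 * B / (1 - M.γ)) := by
  refine (Finset.abs_sum_le_sum_abs _ _).trans ?_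
  have := Finset.sum_le_card_nsmul Finset.univ _ _
    (fun s _ => M.abs_longTermReward_le hr hβ πe πd s)
  rwa [nsmul_eq_mul] at this

/-- The halting round reproduces its pair, so the two policies are best responses to each other. -/
theorem API.isNash {πe πe' : M.EncoderPolicy} {πd πd' : M.DecoderPolicy} {t : ℕ}
    (h : M.API πe πd πe' πd' t) {ξ : S → ℝ} (hξ : ξ ∈ stdSimplex ℝ S) :
    (M.game ξ).IsNash πe' πd' := by
  induction h with
  | halt πe πd vd ve t round =>
    exact ⟨round.encoderOptimal.isBestResponseE hξ, round.decoderOptimal.isBestResponseD hξ⟩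
  | next _ _ _ _ _ _ _ _ _ _ _ _ _ ih => exact ih

section Nonempty

variable [Nonempty S] [Nonempty A]

/-- Alternating policy iteration halts if the encoder's policy is a fixed point of policy iteration:
the total reward increases in every round that changes a policy. -/
theorem exists_api_of_step_eq {πe : M.EncoderPolicy} {πd : M.DecoderPolicy}
    (hs : (M.encoderMDP πd).val.step πe = πe) : ∃ πe' πd' t, M.API πe πd πe' πd' t := by
  have hwf : WellFounded fun p q : M.EncoderPolicy × M.DecoderPolicy =>
      M.totalReward q.1 q.2 < M.totalReward p.1 p.2 := by
    have : Finite (M.EncoderPolicy × M.DecoderPolicy) := inferInstance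
    have : IsTrans (M.EncoderPolicy × M.DecoderPolicy) fun p q =>
        M.totalReward q.1 q.2 < M.totalReward p.1 p.2 := ⟨fun _ _ _ h₁ h₂ => h₂.trans h₁⟩
    have : Std.Irrefl fun p q : M.EncoderPolicy × M.DecoderPolicy =>
        M.totalReward q.1 q.2 < M.totalReward p.1 p.2 := ⟨fun _ => lt_irrefl _⟩
    exact Finite.wellFounded_of_trans_of_irrefl _
  suffices H : ∀ p : M.EncoderPolicy × M.DecoderPolicy, (M.encoderMDP p.2).val.step p.1 = p.1 →
      ∃ πe' πd' t, M.API p.1 p.2 πe' πd' t from H (πe, πd) hs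
  intro p
  induction p using hwf.induction with
  | h p ih =>
    obtain ⟨πe, πd⟩ := p
    intro hs
    obtain ⟨πe₁, πd₁, vd, ve, t, hround⟩ := M.exists_round πe πd
    by_cases hd : πd₁ = πd
    -- With the decoder unchanged, the encoder already starts at a fixed point for it and keeps its
    -- policy, so this round halts.
    · subst hd
      obtain rfl := hround.eq_of_step_eq hs
      exact ⟨_, _, _, .halt _ _ vd ve t hround⟩
    · obtain ⟨s, hlt⟩ := hround.exists_lt hd
      have h₁ := totalReward_add_lt (ε := 0) (s := s) hround.longTermReward_le
        (by rw [add_zero]; exact hlt.trans_le (hround.encoderOptimal πe s))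
      rw [add_zero] at h₁
      obtain ⟨πe', πd', t', h'⟩ := ih (πe₁, πd₁) h₁ hround.step_eq
      exact ⟨_, _, _, .next _ _ _ _ _ _ vd ve t t' hround (fun h => hd h.1) h'⟩

/-- The first round is separate: from an arbitrary start the encoder may improve only at states
outside the initial ones `(s, 0, s)`, which `totalReward` need not detect. Afterwards its policy is
a fixed point. -/
theorem exists_api (πe : M.EncoderPolicy) (πd : M.DecoderPolicy) :
    ∃ πe' πd' t, M.API πe πd πe' πd' t := by
  obtain ⟨πe₁, πd₁, vd, ve, t, hround⟩ := M.exists_round πe πd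
  by_cases h : πd₁ = πd ∧ πe₁ = πe
  · obtain ⟨rfl, rfl⟩ := h
    exact ⟨_, _, _, .halt _ _ vd ve t hround⟩
  · obtain ⟨πe', πd', t', h'⟩ := exists_api_of_step_eq hround.step_eq
    exact ⟨_, _, _, .next _ _ _ _ _ _ vd ve t t' hround h h'⟩

end Nonempty

/-- `APIRounds` grows at its end, whereas the inductions on the remaining gain peel off the first
round. -/
theorem APIRounds.cons {πe πe₁ πe' : M.EncoderPolicy} {πd πd₁ πd' : M.DecoderPolicy} {vd : S → ℝ}
    {ve : M.EncState → ℝ} {t t' n : ℕ} (round : M.Round πe πd πe₁ πd₁ vd ve t)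
    (h : M.APIRounds πe₁ πd₁ n πe' πd' t') :
    M.APIRounds πe πd (n + 1) πe' πd' (t + M.profileSize + t') := by
  induction h with
  | start => simpa using APIRounds.next 0 _ _ _ _ vd ve _ t .start round
  | next n _ _ _ _ vd' ve' t₁ t₂ _ round' ih =>
    have h := APIRounds.next (n + 1) _ _ _ _ vd' ve' _ t₂ ih round'
    rwa [show t + M.profileSize + t₁ + t₂ + M.profileSize =
      t + M.profileSize + (t₁ + t₂ + M.profileSize) by omega] at h

variable {R : ℕ} {c ε : ℝ}

/-- Here `n` counts the gains of size `ε` that still fit below the ceiling `c`; a round that does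
not halt uses up one, and the halting round accounts for the `+ 1`. The returned decoder policy is
an exact best response, and `ve - vd` is the most the encoder could still gain. -/
theorem exists_approxAPI (hR : ∀ πe πd, ∃ πe' πd' vd ve t, M.Round πe πd πe' πd' vd ve t ∧
      t + M.profileSize ≤ R ∧ t + 2 * Fintype.card S ≤ R)
    (hc : ∀ πe πd, M.totalReward πe πd ≤ c) (hε : 0 < ε) (n : ℕ) (πe : M.EncoderPolicy)
    (πd : M.DecoderPolicy) (hn : c - M.totalReward πe πd ≤ n * ε) :
    ∃ πe' πd' t, M.ApproxAPI ε πe πd πe' πd' t ∧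
      (∀ ξ ∈ stdSimplex ℝ S, (M.game ξ).IsEpsNash ε πe' πd') ∧ t ≤ (n + 1) * R := by
  induction n generalizing πe πd with
  | zero =>
    obtain ⟨πe₁, πd₁, vd, ve, t, hround, -, ht⟩ := hR πe πd
    -- The total reward has already reached the ceiling, so no further gain is possible.
    have hclose : ∀ s, ve (s, 0, s) - vd s ≤ ε := by
      intro s
      by_contra! hs
      rw [hround.value_fst, hround.value_snd] at hs
      have h₁ := totalReward_add_lt (ε := ε) (s := s) hround.longTermReward_le
        (by linarith [hround.decoderOptimal πd s])
      have := hc πe₁ πd₁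
      simp only [Nat.cast_zero, zero_mul] at hn
      linarith
    refine ⟨_, _, _, .halt _ _ _ _ vd ve t hround hclose, fun ξ hξ => ⟨?_, ?_⟩, by omega⟩
    · intro πe''
      refine M.payoff_le_add hξ fun s => ?_
      have := hclose s
      rw [hround.value_fst, hround.value_snd] at this
      linarith [hround.encoderOptimal πe'' s]
    · intro πd''
      exact (hround.decoderOptimal.isBestResponseD hξ πd'').trans (le_add_of_nonneg_right hε.le)
  | succ n ih =>
    obtain ⟨πe₁, πd₁, vd, ve, t, hround, -, ht⟩ := hR πe πd
    by_cases hclose : ∀ s, ve (s, 0, s) - vd s ≤ ε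
    · refine ⟨_, _, _, .halt _ _ _ _ vd ve t hround hclose, fun ξ hξ => ⟨?_, ?_⟩, ?_⟩
      · intro πe''
        refine M.payoff_le_add hξ fun s => ?_
        have := hclose s
        rw [hround.value_fst, hround.value_snd] at this
        linarith [hround.encoderOptimal πe'' s]
      · intro πd''
        exact (hround.decoderOptimal.isBestResponseD hξ πd'').trans (le_add_of_nonneg_right hε.le)
      · exact ht.trans (Nat.le_mul_of_pos_left _ (Nat.succ_pos _))
    · obtain ⟨s, hs⟩ := not_forall.1 hclose
      rw [not_le, hround.value_fst, hround.value_snd] at hs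
      have h₁ := totalReward_add_lt (ε := ε) (s := s) hround.longTermReward_le
        (by linarith [hround.decoderOptimal πd s])
      push_cast at hn
      obtain ⟨πe', πd', t', h', hnash, ht'⟩ := ih πe₁ πd₁ (by linarith)
      refine ⟨_, _, _, .next _ _ _ _ _ _ vd ve t t' hround hclose h', hnash, ?_⟩
      rw [add_mul (n + 1) 1, one_mul]
      omega

/-- With the encoder already optimal, only the decoder's possible gain must be at most `ε`. The next
round is inspected to decide this, but its time is charged only if it is carried out. -/
theorem exists_apiRounds_of_encoderOptimal
    (hR : ∀ πe πd, ∃ πe' πd' vd ve t, M.Round πe πd πe' πd' vd ve t ∧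
      t + M.profileSize ≤ R ∧ t + 2 * Fintype.card S ≤ R)
    (hc : ∀ πe πd, M.totalReward πe πd ≤ c) (hε : 0 < ε) (n : ℕ) (πe : M.EncoderPolicy)
    (πd : M.DecoderPolicy) (hopt : M.EncoderOptimal πe πd)
    (hn : c - M.totalReward πe πd ≤ n * ε) :
    ∃ m πe' πd' t, M.APIRounds πe πd m πe' πd' t ∧
      (∀ ξ ∈ stdSimplex ℝ S, (M.game ξ).IsEpsNash ε πe' πd') ∧ t ≤ n * R := by
  induction n generalizing πe πd with
  | zero =>
    obtain ⟨πe₁, πd₁, vd, ve, t, hround, -⟩ := hR πe πd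
    refine ⟨_, _, _, _, .start, fun ξ hξ => ⟨fun πe'' =>
      (hopt.isBestResponseE hξ πe'').trans (le_add_of_nonneg_right hε.le), fun πd'' =>
      M.payoff_le_add hξ fun s => (hround.decoderOptimal πd'' s).trans ?_⟩, Nat.zero_le _⟩
    by_contra! hs
    have h₁ := totalReward_add_lt (ε := ε) (s := s) (hround.decoderOptimal πd) hs
    have := hc πe πd₁
    simp only [Nat.cast_zero, zero_mul] at hn
    linarith
  | succ n ih =>
    obtain ⟨πe₁, πd₁, vd, ve, t, hround, ht, -⟩ := hR πe πd
    by_cases hclose : ∀ s, M.longTermReward πe πd₁ s ≤ M.longTermReward πe πd s + ε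
    · exact ⟨_, _, _, _, .start, fun ξ hξ => ⟨fun πe'' =>
        (hopt.isBestResponseE hξ πe'').trans (le_add_of_nonneg_right hε.le), fun πd'' =>
        M.payoff_le_add hξ fun s => (hround.decoderOptimal πd'' s).trans (hclose s)⟩, Nat.zero_le _⟩
    · obtain ⟨s, hs⟩ := not_forall.1 hclose
      have h₁ := totalReward_add_lt (ε := ε) (s := s) hround.longTermReward_le
        ((not_le.1 hs).trans_le (hround.encoderOptimal πe s))
      push_cast at hn
      obtain ⟨m, πe', πd', t', h', hnash, ht'⟩ :=
        ih πe₁ πd₁ hround.encoderOptimal (by linarith)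
      refine ⟨_, _, _, _, h'.cons hround, hnash, ?_⟩
      rw [add_mul n 1, one_mul]
      omega

/-- One initial round makes the encoder's policy optimal; it is the extra round in the bound. -/
theorem exists_apiRounds (hR : ∀ πe πd, ∃ πe' πd' vd ve t, M.Round πe πd πe' πd' vd ve t ∧
      t + M.profileSize ≤ R ∧ t + 2 * Fintype.card S ≤ R)
    (hc : ∀ πe πd, M.totalReward πe πd ≤ c) (hε : 0 < ε) (n : ℕ) (πe : M.EncoderPolicy)
    (πd : M.DecoderPolicy) (hn : c - M.totalReward πe πd ≤ n * ε) :
    ∃ m πe' πd' t, M.APIRounds πe πd m πe' πd' t ∧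
      (∀ ξ ∈ stdSimplex ℝ S, (M.game ξ).IsEpsNash ε πe' πd') ∧ t ≤ (n + 1) * R := by
  obtain ⟨πe₁, πd₁, vd, ve, t, hround, ht, -⟩ := hR πe πd
  have hle : M.totalReward πe πd ≤ M.totalReward πe₁ πd₁ :=
    Finset.sum_le_sum fun s _ => hround.longTermReward_le s
  obtain ⟨m, πe', πd', t', h', hnash, ht'⟩ :=
    exists_apiRounds_of_encoderOptimal hR hc hε n πe₁ πd₁ hround.encoderOptimal (by linarith)
  refine ⟨_, _, _, _, h'.cons hround, hnash, ?_⟩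
  rw [add_mul n 1, one_mul]
  omega

end Convergence

end RemoteControl

/-! ### Assembly and choice of the constants -/

theorem mainTheorem5 :
    (∀ (S A : Type) [FinEnum S] [FinEnum A] [Nonempty S] [Nonempty A] (M : RemoteControl S A),
      -- exact potential game
      (∀ ξ ∈ stdSimplex ℝ S, (M.game ξ).IsExactPotential (M.payoff ξ)) ∧
      -- every round can be carried out, and its two phases are best responses
      (∀ (πe : M.EncoderPolicy) (πd : M.DecoderPolicy),
        (∃ πe' πd' vd ve t, M.Round πe πd πe' πd' vd ve t) ∧
        ∀ πe' πd' vd ve t, M.Round πe πd πe' πd' vd ve t → ∀ ξ ∈ stdSimplex ℝ S,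
          (M.game ξ).IsBestResponseD πd' πe ∧ (M.game ξ).IsBestResponseE πe' πd') ∧
      -- convergence to a Nash equilibrium in finitely many steps
      (∀ (πe : M.EncoderPolicy) (πd : M.DecoderPolicy),
        ∃ πe' πd' t, M.API πe πd πe' πd' t ∧
          ∀ ξ ∈ stdSimplex ℝ S, (M.game ξ).IsNash πe' πd')) ∧
    -- an `ε`-Nash equilibrium in polynomial time
    (∀ T : ℕ, ∃ q : ℕ, ∀ γ : ℝ, 0 ≤ γ → γ < 1 → ∃ K : ℝ,
      ∀ (S A : Type) [FinEnum S] [FinEnum A] [Nonempty S] [Nonempty A] (M : RemoteControl S A)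
        (B : ℝ), M.Tmax = T → M.γ = γ → (∀ s a s', |M.r s a s'| ≤ B) → M.β ≤ B →
      ∀ ε : ℝ, 0 < ε → ∀ (πe : M.EncoderPolicy) (πd : M.DecoderPolicy),
        (∃ n πe' πd' t, M.APIRounds πe πd n πe' πd' t ∧
          (∀ ξ ∈ stdSimplex ℝ S, (M.game ξ).IsEpsNash ε πe' πd') ∧
          (t : ℝ) ≤ K * ((Fintype.card A : ℝ) * Fintype.card S) ^ q * (1 + B / ε)) ∧
        (∃ πe' πd' t, M.ApproxAPI ε πe πd πe' πd' t ∧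
          (∀ ξ ∈ stdSimplex ℝ S, (M.game ξ).IsEpsNash ε πe' πd') ∧
          (t : ℝ) ≤ K * ((Fintype.card A : ℝ) * Fintype.card S) ^ q * (1 + B / ε))) := by
  refine ⟨fun S A _ _ _ _ M => ⟨fun ξ _ => ⟨fun _ _ _ => rfl, fun _ _ _ => rfl⟩,
    fun πe πd => ⟨M.exists_round πe πd, fun πe' πd' vd ve t h ξ hξ =>
      ⟨h.decoderOptimal.isBestResponseD hξ, h.encoderOptimal.isBestResponseE hξ⟩⟩,
    fun πe πd => ?_⟩, fun T => ⟨2 * T + 9, fun γ hγ₀ hγ₁ => ?_⟩⟩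
  · obtain ⟨πe', πd', t, h⟩ := RemoteControl.exists_api πe πd
    exact ⟨πe', πd', t, h, fun ξ hξ => h.isNash hξ⟩
  have hγ : 0 < 1 - γ := sub_pos.2 hγ₁
  obtain ⟨k, hk⟩ := exists_pow_lt_of_lt_one hγ hγ₁
  -- The constant depends only on `T` and `γ`, since `k` is chosen from `γ` alone.
  refine ⟨RemoteControl.roundCoeff T k * (2 + 4 / (1 - γ)), ?_⟩
  intro S A _ _ _ _ M B hT hγM hr hβ ε hε πe πd
  subst hT hγM
  have hB : 0 ≤ B := M.β_nonneg.trans hβ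
  have hN : (1 : ℝ) ≤ Fintype.card S := by exact_mod_cast Fintype.card_pos (α := S)
  have hA : (1 : ℝ) ≤ Fintype.card A := by exact_mod_cast Fintype.card_pos (α := A)
  have hc := fun πe πd => abs_le.1 (M.abs_totalReward_le hr hβ πe πd)
  set c : ℝ := Fintype.card S * (2 * B / (1 - M.γ)) with hcdef
  have hc₀ : 0 ≤ c := by positivity
  -- The total reward lies in `[-c, c]`, so at most `2 * c` can be gained.
  have hn : c - M.totalReward πe πd ≤ (⌈2 * c / ε⌉₊ : ℕ) * ε := by
    have h₁ := (div_le_iff₀ hε).1 (Nat.le_ceil (2 * c / ε))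
    linarith [(hc πe πd).1]
  have hceil : ((⌈2 * c / ε⌉₊ : ℕ) : ℝ) < 2 * c / ε + 1 := Nat.ceil_lt_add_one (by positivity)
  set y : ℝ := (Fintype.card A : ℝ) * Fintype.card S with hy
  have hNy : (Fintype.card S : ℝ) ≤ y := le_mul_of_one_le_left (by positivity) hA
  have hy₁ : 1 ≤ y := hN.trans hNy
  -- One unit of the `2` is for rounding up, the other for the extra round. The factor `|S| ≤ y` in
  -- `c` raises the exponent from `2 * T + 8` to `2 * T + 9`.
  have hcount : 2 * c / ε + 2 ≤ (2 + 4 / (1 - M.γ)) * y * (1 + B / ε) := by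
    have e : 2 * c / ε = 4 / (1 - M.γ) * (Fintype.card S * (B / ε)) := by
      rw [hcdef]
      field_simp
      ring
    have h₁ : (Fintype.card S : ℝ) * (B / ε) ≤ y * (1 + B / ε) := by
      gcongr
      linarith
    have h₂ : 1 ≤ y * (1 + B / ε) := by
      have : 0 ≤ B / ε := by positivity
      nlinarith
    have h₃ : 0 ≤ 4 / (1 - M.γ) := by positivity
    rw [e]
    nlinarith [mul_le_mul_of_nonneg_left h₁ h₃]
  have htime : ∀ t : ℕ, t ≤ (⌈2 * c / ε⌉₊ + 1) * (RemoteControl.roundCoeff M.Tmax k *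
      (Fintype.card A * Fintype.card S) ^ (2 * M.Tmax + 8)) →
      (t : ℝ) ≤ RemoteControl.roundCoeff M.Tmax k * (2 + 4 / (1 - M.γ)) * y ^ (2 * M.Tmax + 9) *
        (1 + B / ε) := by
    intro t ht
    have ht' : (t : ℝ) ≤ ((⌈2 * c / ε⌉₊ : ℕ) + 1) *
        (RemoteControl.roundCoeff M.Tmax k * y ^ (2 * M.Tmax + 8)) := by
      rw [hy]
      exact_mod_cast ht
    refine ht'.trans ?_
    calc _ ≤ (2 + 4 / (1 - M.γ)) * y * (1 + B / ε) *
          (RemoteControl.roundCoeff M.Tmax k * y ^ (2 * M.Tmax + 8)) := by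
          gcongr
          linarith
      _ = _ := by ring
  have hR := M.exists_round_time_le hk
  constructor
  · obtain ⟨m, πe', πd', t, h, hnash, ht⟩ :=
      RemoteControl.exists_apiRounds hR (fun πe πd => (hc πe πd).2) hε _ πe πd hn
    exact ⟨m, πe', πd', t, h, hnash, htime t ht⟩
  · obtain ⟨πe', πd', t, h, hnash, ht⟩ :=
      RemoteControl.exists_approxAPI hR (fun πe πd => (hc πe πd).2) hε _ πe πd hn
    exact ⟨πe', πd', t, h, hnash, htime t ht⟩
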